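/- Let $H_b\in\mathbb C^{N_r\times N_t}$, $H_e\in\mathbb C^{N_e\times N_t}$ and $H=\begin{bmatrix}H_b\\ H_e\end{bmatrix}$. Let $\mathcal X$ be a compact convex set of positive semidefinite matrices in $\mathbb C^{N_t\times N_t}$ (for instance the set cut out of the positive semidefinite cone by a sum power constraint, by per-antenna power constraints, or by either of these together with interference power constraints), and let $$\mathcal K=\Big\{K=\begin{bmatrix}I&\bar K\\ \bar K^{\mathsf H}&I\end{bmatrix}:\ \bar K\in\mathbb C^{N_r\times N_e},\ K\succeq 0\Big\}.$$ For $K\in\mathcal K$ with $K\succ0$ and $X\in\mathcal X$ put $$f(K,X)=\log\frac{|I+K^{-1}HXH^{\mathsf H}|}{|I+H_eXH_e^{\mathsf H}|},$$ and for singular $K\in\mathcal K$ let $f(K,X)=\lim_{\varepsilon\downarrow0}f(K+\varepsilon I,X)\in(-\infty,+\infty]$, where $f(K+\varepsilon I,X)$ is given by the same formula. Let $\{(X_n,K_n)\}_{n\ge1}$ be generated by the partial best response algorithm: $K_1\in\mathcal K$, $K_1\succ0$, and for $n\ge1$ $$X_n\in\arg\max_{X\in\mathcal X} f(K_n,X),\qquad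 K_{n+1}\in\arg\min_{K\in\mathcal K}\ \operatorname{tr}(\Psi_nK)-\log|K|,\qquad \Psi_n=(K_n+HX_nH^{\mathsf H})^{-1},$$ with $-\log|K|=+\infty$ for singular $K$. Then: 1. $f(K_n,X_n)\ge0$ and $f(K_{n+1},X_{n+1})\le f(K_n,X_n)$ for all $n$, and hence $\{f(K_n,X_n)\}$ converges. 2. $\{(X_n,K_n)\}$ has a convergent subsequence. 3. Every limit point $(X^*,K^*)$ of $\{(X_n,K_n)\}$ is a saddle point of $\min_{K\in\mathcal K}\max_{X\in\mathcal X}f(K,X)$, that is, $X^*\in\mathcal X$, $K^*\in\mathcal K$, and $$f(K^*,X)\le f(K^*,X^*)\le f(K,X^*)\qquad\text{for all }X\in\mathcal X,\ K\in\mathcal K .$$ -/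

import Mathlib

open Matrix Filter Topology
open scoped ComplexOrder

noncomputable section

namespace Wiretap

/-- The extended channel `H = [H_bᵀ, H_eᵀ]ᵀ`, i.e. `H_b` stacked on top of `H_e`. -/
def extChannel {Nt Nr Ne : ℕ} (Hb : Matrix (Fin Nr) (Fin Nt) ℂ) (He : Matrix (Fin Ne) (Fin Nt) ℂ) :
    Matrix (Fin Nr ⊕ Fin Ne) (Fin Nt) ℂ :=
  Matrix.fromRows Hb He

/-- The set `𝒦` of composite noise covariances: positive semidefinite matrices with identity
diagonal blocks and off-diagonal blocks `K̄`, `K̄ᴴ`. -/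
def noiseSet (Nr Ne : ℕ) : Set (Matrix (Fin Nr ⊕ Fin Ne) (Fin Nr ⊕ Fin Ne) ℂ) :=
  {K | (∃ Kbar : Matrix (Fin Nr) (Fin Ne) ℂ, K = Matrix.fromBlocks 1 Kbar Kbarᴴ 1) ∧ K.PosSemidef}

/-- The objective `f(K, X) = log (|I + K⁻¹ H X Hᴴ| / |I + H_e X H_eᴴ|)`. It is used at positive
definite `K` and positive semidefinite `X` only, where both determinants are positive reals. -/
def objective {Nt Nr Ne : ℕ} (Hb : Matrix (Fin Nr) (Fin Nt) ℂ) (He : Matrix (Fin Ne) (Fin Nt) ℂ)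
    (K : Matrix (Fin Nr ⊕ Fin Ne) (Fin Nr ⊕ Fin Ne) ℂ) (X : Matrix (Fin Nt) (Fin Nt) ℂ) : ℝ :=
  Real.log ((1 + K⁻¹ * (extChannel Hb He * X * (extChannel Hb He)ᴴ)).det.re /
    (1 + He * X * Heᴴ).det.re)

open Classical in
/-- The objective on all of `𝒦 × 𝒳`, with values in `[-∞, +∞]`. At an invertible `K` it is
`f(K, X)`. At a singular `K`, where `K⁻¹` has no meaning, it is the limit of `f(K + ε I, X)` as
`ε ↓ 0`; since `f(K + ε I, X)` grows as `ε` decreases, this limit is a supremum. -/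
def extObjective {Nt Nr Ne : ℕ} (Hb : Matrix (Fin Nr) (Fin Nt) ℂ)
    (He : Matrix (Fin Ne) (Fin Nt) ℂ)
    (K : Matrix (Fin Nr ⊕ Fin Ne) (Fin Nr ⊕ Fin Ne) ℂ) (X : Matrix (Fin Nt) (Fin Nt) ℂ) : EReal :=
  if K.PosDef then (objective Hb He K X : EReal)
  else ⨆ ε : {ε : ℝ // 0 < ε}, (objective Hb He (K + (ε : ℝ) • 1) X : EReal)

/-- `(X*, K*)` is a saddle point of `min_{K ∈ 𝒦} max_{X ∈ 𝒳} f(K, X)`. -/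
def IsSaddlePoint {Nt Nr Ne : ℕ} (Hb : Matrix (Fin Nr) (Fin Nt) ℂ)
    (He : Matrix (Fin Ne) (Fin Nt) ℂ) (𝒳 : Set (Matrix (Fin Nt) (Fin Nt) ℂ))
    (Xs : Matrix (Fin Nt) (Fin Nt) ℂ) (Ks : Matrix (Fin Nr ⊕ Fin Ne) (Fin Nr ⊕ Fin Ne) ℂ) : Prop :=
  Xs ∈ 𝒳 ∧ Ks ∈ noiseSet Nr Ne ∧
    (∀ X ∈ 𝒳, extObjective Hb He Ks X ≤ extObjective Hb He Ks Xs) ∧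
    (∀ K ∈ noiseSet Nr Ne, extObjective Hb He Ks Xs ≤ extObjective Hb He K Xs)

/-- The objective `tr(Ψ K) - log |K|` of the `K`-update. It is used at positive definite `K` only. -/
def updateObjective {Nr Ne : ℕ} (Ψ K : Matrix (Fin Nr ⊕ Fin Ne) (Fin Nr ⊕ Fin Ne) ℂ) : ℝ :=
  (Ψ * K).trace.re - Real.log K.det.re

/-- `(X_n, K_n)` is a sequence of iterates of the partial best response algorithm (indexed from
`0`): `K_0 ∈ 𝒦` is invertible, `X_n` maximizes `f(K_n, ·)` over `𝒳`, and `K_{n+1}` minimizes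
`tr(Ψ_n K) - log |K|` over `𝒦`, where `Ψ_n = (K_n + H X_n Hᴴ)⁻¹`. In the last problem
`-log |K| = +∞` at singular `K`, so it is a minimization over the positive definite `K ∈ 𝒦`. -/
structure IsPBRA {Nt Nr Ne : ℕ} (Hb : Matrix (Fin Nr) (Fin Nt) ℂ) (He : Matrix (Fin Ne) (Fin Nt) ℂ)
    (𝒳 : Set (Matrix (Fin Nt) (Fin Nt) ℂ))
    (X : ℕ → Matrix (Fin Nt) (Fin Nt) ℂ)
    (K : ℕ → Matrix (Fin Nr ⊕ Fin Ne) (Fin Nr ⊕ Fin Ne) ℂ) : Prop where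
  init_mem : K 0 ∈ noiseSet Nr Ne
  init_posDef : (K 0).PosDef
  X_mem : ∀ n, X n ∈ 𝒳
  X_max : ∀ n, ∀ X' ∈ 𝒳, objective Hb He (K n) X' ≤ objective Hb He (K n) (X n)
  K_mem : ∀ n, K (n + 1) ∈ noiseSet Nr Ne
  K_posDef : ∀ n, (K (n + 1)).PosDef
  K_min : ∀ n, ∀ K' ∈ noiseSet Nr Ne, K'.PosDef →
    updateObjective (K n + extChannel Hb He * X n * (extChannel Hb He)ᴴ)⁻¹ (K (n + 1)) ≤
      updateObjective (K n + extChannel Hb He * X n * (extChannel Hb He)ᴴ)⁻¹ K'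

end Wiretap

end

noncomputable section

/-! On `noiseSet` the lower right block of K is I, so with M = K + HXHᴴ the objective is log|S(M)| −
log|K|, S being the Schur complement of that block (`objective_eq_schur`). The function log|S| is
concave (`logDet_schur_le`), and its gradient differs from M⁻¹ only in the lower right block, where
all noise covariances coincide. Linearizing at (K_n, X_n), with X_n a best response, bounds the
objective from above at every other pair; so it drops at each step by at least the decrease of
tr(Ψ_n K) − log|K| (`objective_le_add_updateObjective`). By stationarity of K_{n+1}, Ψ_n and
K_{n+1}⁻¹ share their off-diagonal blocks, and that decrease is the log-determinant divergence of
K_n from K_{n+1} (`updateObjective_sub_eq`). It tends to 0, so consecutive K agree in the Loewner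
order up to factors tending to 1, even when they approach a singular matrix.

Let l be the limit of the values. Best responses and lower semicontinuity give f(K*, X) ≤ l. For l ≤
f(K, X*) no derivative at K* is available if K* is singular. Instead stationarity is written without
K⁻¹, as Y K̄ = L with L = `regr M` and Y = S(M) + L K̄ᴴ; this passes to the limit, with log|Y| ≥ l.
Such a Y certifies log|Y| ≤ f(K, X*) for every definite K (`logDet_le_of_regr_eq`): on a suitable
part of the signal the eavesdropper is degraded, and the difference of the two rates there is
log|Y|. The two bounds meet at l and give both saddle inequalities. -/

namespace Wiretap

set_option linter.unusedSectionVars false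

/-! ### Log-determinants through relative eigenvalues. -/

section LogDet

variable {n : Type*} [Fintype n] [DecidableEq n]

/-- The logarithm of the (real part of the) determinant. -/
def logDet (A : Matrix n n ℂ) : ℝ := Real.log A.det.re

theorem exists_eq_conjTranspose_mul_self {A : Matrix n n ℂ} (hA : A.PosSemidef) :
    ∃ R : Matrix n n ℂ, A = Rᴴ * R := by
  open scoped MatrixOrder in
  have h0 : (0 : Matrix n n ℂ) ≤ A := Matrix.nonneg_iff_posSemidef.2 hA
  open scoped MatrixOrder in
  have hs : (CFC.sqrt A)ᴴ = CFC.sqrt A :=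
    (Matrix.nonneg_iff_posSemidef.1 (CFC.sqrt_nonneg A)).isHermitian
  open scoped MatrixOrder in
  exact ⟨CFC.sqrt A, by rw [hs, CFC.sqrt_mul_sqrt_self A h0]⟩

/-- Simultaneous diagonalization by congruence. -/
theorem exists_simultaneous_diagonalization {A B : Matrix n n ℂ} (hB : B.PosDef)
    (hA : A.IsHermitian) : ∃ (G : Matrix n n ℂ) (l : n → ℝ), IsUnit G ∧ B = Gᴴ * G ∧
      A = Gᴴ * diagonal (fun i => (l i : ℂ)) * G := by
  obtain ⟨R, hR⟩ := exists_eq_conjTranspose_mul_self hB.posSemidef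
  have hRu : IsUnit R.det := by
    have h1 := hB.det_pos.ne'
    rw [hR, det_mul] at h1
    exact isUnit_iff_ne_zero.2 (right_ne_zero_of_mul h1)
  have hC : (R⁻¹ᴴ * A * R⁻¹).IsHermitian := by
    simp only [IsHermitian, conjTranspose_mul, conjTranspose_conjTranspose, hA.eq, Matrix.mul_assoc]
  have hUU : (hC.eigenvectorUnitary : Matrix n n ℂ) * (hC.eigenvectorUnitary : Matrix n n ℂ)ᴴ = 1 :=
    Unitary.coe_mul_star_self hC.eigenvectorUnitary
  have hspec := hC.spectral_theorem
  rw [Unitary.conjStarAlgAut_apply] at hspec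
  generalize (hC.eigenvectorUnitary : Matrix n n ℂ) = U at hspec hUU
  have hU : IsUnit U.det := by
    refine IsUnit.of_mul_eq_one (Uᴴ.det) ?_
    rw [← det_mul, hUU, det_one]
  refine ⟨Uᴴ * R, hC.eigenvalues, ?_, ?_, ?_⟩
  · rw [Matrix.isUnit_iff_isUnit_det, det_mul, det_conjTranspose]
    exact hU.star.mul hRu
  · rw [conjTranspose_mul, conjTranspose_conjTranspose, Matrix.mul_assoc, ← Matrix.mul_assoc U, hUU,
      Matrix.one_mul, hR]
  · have h2 : A = Rᴴ * (R⁻¹ᴴ * A * R⁻¹) * R := by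
      have h3 : Rᴴ * R⁻¹ᴴ = 1 := by
        rw [← conjTranspose_mul, Matrix.nonsing_inv_mul _ hRu, conjTranspose_one]
      calc A = (Rᴴ * R⁻¹ᴴ) * A * (R⁻¹ * R) := by
            rw [h3, Matrix.nonsing_inv_mul _ hRu, Matrix.one_mul, Matrix.mul_one]
        _ = _ := by simp only [Matrix.mul_assoc]
    generalize hC.eigenvalues = l at hspec ⊢
    rw [h2, hspec]
    simp only [conjTranspose_mul, conjTranspose_conjTranspose, Matrix.mul_assoc]
    rfl

theorem posSemidef_conjTranspose_diagonal_mul_iff {G : Matrix n n ℂ} (hG : IsUnit G) (l : n → ℝ) :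
    (Gᴴ * diagonal (fun i => (l i : ℂ)) * G).PosSemidef ↔ ∀ i, 0 ≤ l i := by
  have h := hG.posSemidef_star_left_conjugate_iff (x := diagonal (fun i => (l i : ℂ)))
  rw [star_eq_conjTranspose] at h
  rw [h, posSemidef_diagonal_iff]
  simp

theorem posDef_iff_re_det_pos {A : Matrix n n ℂ} (hA : A.PosSemidef) :
    A.PosDef ↔ 0 < A.det.re := by
  rw [hA.posDef_iff_det_ne_zero]
  have h := Complex.nonneg_iff.1 hA.det_nonneg
  constructor
  · intro h0
    refine lt_of_le_of_ne h.1 fun h1 => h0 (Complex.ext h1.symm h.2.symm)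
  · intro h0 h1
    simp [h1] at h0

theorem re_det_pos {A : Matrix n n ℂ} (hA : A.PosDef) : 0 < A.det.re :=
  (posDef_iff_re_det_pos hA.posSemidef).1 hA

theorem det_eq_re {A : Matrix n n ℂ} (hA : A.PosSemidef) : A.det = (A.det.re : ℂ) :=
  Complex.ext rfl (Complex.nonneg_iff.1 hA.det_nonneg).2.symm

/-- The eigenvalues of `A` relative to `B` and what they determine. -/
theorem exists_relative_eigenvalues {A B : Matrix n n ℂ} (hA : A.PosDef) (hB : B.PosDef) :
    ∃ l : n → ℝ, (∀ i, 0 < l i) ∧ logDet A - logDet B = ∑ i, Real.log (l i) ∧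
      (B⁻¹ * A).trace.re = ∑ i, l i ∧
      (∀ a : ℝ, (A - a • B).PosSemidef ↔ ∀ i, a ≤ l i) ∧
      (∀ a : ℝ, (a • B - A).PosSemidef ↔ ∀ i, l i ≤ a) := by
  obtain ⟨G, l, hG, hBG, hAG⟩ := exists_simultaneous_diagonalization hB hA.isHermitian
  have hsub (a : ℝ) : A - a • B = Gᴴ * diagonal (fun i => ((l i - a : ℝ) : ℂ)) * G := by
    have : diagonal (fun i => ((l i - a : ℝ) : ℂ)) = diagonal (fun i => (l i : ℂ)) - a • 1 := by
      ext i j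
      by_cases h : i = j <;> simp [h]
    rw [this, Matrix.mul_sub, Matrix.sub_mul, ← hAG]
    simp [hBG]
  have hsub' (a : ℝ) : a • B - A = Gᴴ * diagonal (fun i => ((a - l i : ℝ) : ℂ)) * G := by
    have h1 : diagonal (fun i => ((a - l i : ℝ) : ℂ)) = - diagonal (fun i => ((l i - a : ℝ) : ℂ)) := by
      ext i j
      by_cases h : i = j <;> simp [h]
    rw [h1, Matrix.mul_neg, Matrix.neg_mul, ← hsub, neg_sub]
  have hGd : IsUnit G.det := (Matrix.isUnit_iff_isUnit_det _).1 hG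
  have hdet : A.det = B.det * ((∏ i, l i : ℝ) : ℂ) := by
    rw [hAG, hBG]
    simp only [det_mul, det_diagonal]
    push_cast
    ring
  have hdre : A.det.re = B.det.re * ∏ i, l i := by
    rw [hdet, Complex.re_mul_ofReal]
  have hnn : ∀ i, 0 ≤ l i := by
    rw [← posSemidef_conjTranspose_diagonal_mul_iff hG, ← hAG]
    exact hA.posSemidef
  have hpos : ∀ i, 0 < l i := by
    intro i
    refine lt_of_le_of_ne (hnn i) fun h => ?_
    have h1 := re_det_pos hA
    rw [hdre, Finset.prod_eq_zero (Finset.mem_univ i) h.symm, mul_zero] at h1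
    exact lt_irrefl _ h1
  refine ⟨l, hpos, ?_, ?_, fun a => ?_, fun a => ?_⟩
  · rw [logDet, logDet, hdre, Real.log_mul (re_det_pos hB).ne'
      (Finset.prod_pos fun i _ => hpos i).ne', Real.log_prod fun i _ => (hpos i).ne']
    ring
  · have h1 : B⁻¹ * A = G⁻¹ * (diagonal (fun i => (l i : ℂ)) * G) := by
      have hGH : IsUnit Gᴴ.det := by rw [det_conjTranspose]; exact hGd.star
      rw [hBG, hAG, Matrix.mul_inv_rev, Matrix.mul_assoc, Matrix.mul_assoc Gᴴ,
        Matrix.nonsing_inv_mul_cancel_left _ _ hGH]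
    rw [h1, Matrix.trace_mul_comm, Matrix.mul_assoc, Matrix.mul_nonsing_inv _ hGd, Matrix.mul_one,
      trace_diagonal]
    simp
  · rw [hsub, posSemidef_conjTranspose_diagonal_mul_iff hG]
    simp
  · rw [hsub', posSemidef_conjTranspose_diagonal_mul_iff hG]
    simp

theorem logDet_mono {A B : Matrix n n ℂ} (hA : A.PosDef) (hB : B.PosDef)
    (h : (A - B).PosSemidef) : logDet B ≤ logDet A := by
  obtain ⟨l, -, hlog, -, h1, -⟩ := exists_relative_eigenvalues hA hB
  have h2 := (h1 1).1 (by simpa using h)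
  have : 0 ≤ ∑ i, Real.log (l i) := Finset.sum_nonneg fun i _ => Real.log_nonneg (h2 i)
  linarith

/-- Sum of log x ≤ x − 1 over the relative eigenvalues: the tangent bound at B for the concave
log-determinant. -/
theorem logDet_le_add_trace {A B : Matrix n n ℂ} (hA : A.PosDef) (hB : B.PosDef) :
    logDet A ≤ logDet B + (B⁻¹ * A).trace.re - Fintype.card n := by
  obtain ⟨l, hl, hlog, htr, -, -⟩ := exists_relative_eigenvalues hA hB
  have : ∑ i, Real.log (l i) ≤ ∑ i, (l i - 1) :=
    Finset.sum_le_sum fun i _ => Real.log_le_sub_one_of_pos (hl i)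
  rw [Finset.sum_sub_distrib, ← htr] at this
  simp at this
  linarith

/-- Twice log √x ≤ √x − 1. It turns a small divergence into a bound on |√x − 1|, hence the squares
(1 ± δ)² below. -/
theorem sq_sqrt_sub_one_le {x : ℝ} (hx : 0 < x) : (√x - 1) ^ 2 ≤ x - 1 - Real.log x := by
  have h1 := Real.log_le_sub_one_of_pos (Real.sqrt_pos.2 hx)
  have h2 : Real.log x = 2 * Real.log √x := by
    rw [Real.log_sqrt hx.le]; ring
  have h3 := Real.sq_sqrt hx.le
  nlinarith

/-- A small log-determinant divergence forces two positive definite matrices to be close in the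
Loewner order. -/
theorem close_of_divergence_le {A B : Matrix n n ℂ} (hA : A.PosDef) (hB : B.PosDef) {δ : ℝ}
    (hδ0 : 0 ≤ δ) (hδ1 : δ < 1)
    (h : (B⁻¹ * A).trace.re - Fintype.card n - (logDet A - logDet B) ≤ δ ^ 2) :
    (A - (1 - δ) ^ 2 • B).PosSemidef ∧ ((1 + δ) ^ 2 • B - A).PosSemidef ∧
      Fintype.card n * Real.log ((1 - δ) ^ 2) ≤ logDet A - logDet B := by
  obtain ⟨l, hl, hlog, htr, h1, h2⟩ := exists_relative_eigenvalues hA hB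
  have hsum : ∑ i, (l i - 1 - Real.log (l i)) ≤ δ ^ 2 := by
    rw [Finset.sum_sub_distrib, Finset.sum_sub_distrib, ← htr, ← hlog]
    simpa using h
  -- All terms of the divergence are nonnegative, so each one is at most δ².
  have hi (i : n) : |√(l i) - 1| ≤ δ := by
    refine abs_le_of_sq_le_sq ((sq_sqrt_sub_one_le (hl i)).trans (le_trans ?_ hsum)) hδ0
    exact Finset.single_le_sum (f := fun i => l i - 1 - Real.log (l i))
      (fun j _ => (sq_nonneg _).trans (sq_sqrt_sub_one_le (hl j))) (Finset.mem_univ i)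
  have hlo (i : n) : (1 - δ) ^ 2 ≤ l i := by
    have h3 := abs_le.1 (hi i)
    have h4 := Real.sq_sqrt (hl i).le
    nlinarith
  have hup (i : n) : l i ≤ (1 + δ) ^ 2 := by
    have h3 := abs_le.1 (hi i)
    have h4 := Real.sq_sqrt (hl i).le
    have h5 := Real.sqrt_nonneg (l i)
    nlinarith
  refine ⟨(h1 _).2 hlo, (h2 _).2 hup, ?_⟩
  rw [hlog, ← nsmul_eq_mul, ← Finset.card_univ, ← Finset.sum_const]
  exact Finset.sum_le_sum fun i _ => Real.log_le_log (by nlinarith) (hlo i)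

end LogDet

/-! ### Schur complements and the concavity of their log-determinant. -/

section Schur

variable {m n : Type*} [Fintype m] [Fintype n] [DecidableEq m] [DecidableEq n]

/-- The matrix `[I, -L]`. -/
def elim (L : Matrix m n ℂ) : Matrix m (m ⊕ n) ℂ := fromCols 1 (-L)

/-- The linear regression coefficients `M₁₂ M₂₂⁻¹`. -/
def regr (M : Matrix (m ⊕ n) (m ⊕ n) ℂ) : Matrix m n ℂ := M.toBlocks₁₂ * M.toBlocks₂₂⁻¹

/-- The Schur complement of the lower right block. -/
def schur (M : Matrix (m ⊕ n) (m ⊕ n) ℂ) : Matrix m m ℂ :=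
  M.toBlocks₁₁ - regr M * M.toBlocks₂₁

/-- The gradient of `M ↦ log |schur M|`. -/
def schurGrad (M : Matrix (m ⊕ n) (m ⊕ n) ℂ) : Matrix (m ⊕ n) (m ⊕ n) ℂ :=
  (elim (regr M))ᴴ * (schur M)⁻¹ * elim (regr M)

theorem elim_mul (L : Matrix m n ℂ) (M : Matrix (m ⊕ n) (m ⊕ n) ℂ) :
    elim L * M = fromCols (M.toBlocks₁₁ - L * M.toBlocks₂₁) (M.toBlocks₁₂ - L * M.toBlocks₂₂) := by
  conv_lhs => rw [← fromBlocks_toBlocks M]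
  rw [elim, fromCols_mul_fromBlocks]
  simp [sub_eq_add_neg]

theorem fromCols_mul_elim_conjTranspose (L : Matrix m n ℂ) (A : Matrix m m ℂ) (B : Matrix m n ℂ) :
    fromCols A B * (elim L)ᴴ = A - B * Lᴴ := by
  rw [elim, conjTranspose_fromCols_eq_fromRows_conjTranspose, fromCols_mul_fromRows]
  simp [sub_eq_add_neg]

theorem posDef_toBlocks₂₂ {M : Matrix (m ⊕ n) (m ⊕ n) ℂ} (hM : M.PosDef) : M.toBlocks₂₂.PosDef :=
  hM.submatrix Sum.inr_injective

theorem conjTranspose_toBlocks₁₂ {M : Matrix (m ⊕ n) (m ⊕ n) ℂ} (hM : M.IsHermitian) :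
    M.toBlocks₁₂ᴴ = M.toBlocks₂₁ := by
  ext i j
  exact hM.apply _ _

theorem conjTranspose_toBlocks₂₁ {M : Matrix (m ⊕ n) (m ⊕ n) ℂ} (hM : M.IsHermitian) :
    M.toBlocks₂₁ᴴ = M.toBlocks₁₂ := by
  ext i j
  exact hM.apply _ _

theorem regr_mul {M : Matrix (m ⊕ n) (m ⊕ n) ℂ} (h : M.toBlocks₂₂.PosDef) :
    regr M * M.toBlocks₂₂ = M.toBlocks₁₂ :=
  Matrix.nonsing_inv_mul_cancel_right _ _ ((Matrix.isUnit_iff_isUnit_det _).1 h.isUnit)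

theorem conjTranspose_regr {M : Matrix (m ⊕ n) (m ⊕ n) ℂ} (hM : M.IsHermitian)
    (h : M.toBlocks₂₂.PosDef) : (regr M)ᴴ = M.toBlocks₂₂⁻¹ * M.toBlocks₂₁ := by
  rw [regr, conjTranspose_mul, h.isHermitian.inv.eq, conjTranspose_toBlocks₁₂ hM]

theorem elim_regr_mul {M : Matrix (m ⊕ n) (m ⊕ n) ℂ} (h : M.toBlocks₂₂.PosDef) :
    elim (regr M) * M = fromCols (schur M) 0 := by
  rw [elim_mul, regr_mul h, sub_self, schur]

theorem elim_regr_mul_mul {M : Matrix (m ⊕ n) (m ⊕ n) ℂ} (h : M.toBlocks₂₂.PosDef) :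
    elim (regr M) * M * (elim (regr M))ᴴ = schur M := by
  rw [elim_regr_mul h, fromCols_mul_elim_conjTranspose]
  simp

/-- Completing the square: the error covariance of predicting the first block by L times the second
is smallest at L = `regr M`. -/
theorem elim_mul_mul {M : Matrix (m ⊕ n) (m ⊕ n) ℂ} (hM : M.IsHermitian)
    (h : M.toBlocks₂₂.PosDef) (L : Matrix m n ℂ) :
    elim L * M * (elim L)ᴴ =
      schur M + (L - regr M) * M.toBlocks₂₂ * (L - regr M)ᴴ := by
  have h1 := regr_mul h
  have h2 : M.toBlocks₂₂ * (regr M)ᴴ = M.toBlocks₂₁ := by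
    rw [← conjTranspose_toBlocks₁₂ hM, ← h1, conjTranspose_mul, h.isHermitian.eq]
  have h3 : M.toBlocks₁₂ * (regr M)ᴴ = regr M * M.toBlocks₂₁ := by
    rw [← h1, Matrix.mul_assoc, h2]
  rw [elim_mul, fromCols_mul_elim_conjTranspose, schur, Matrix.sub_mul L, h1, conjTranspose_sub,
    Matrix.mul_sub]
  simp only [Matrix.sub_mul]
  rw [Matrix.mul_assoc L _ (regr M)ᴴ, h2, h3]
  abel

theorem posDef_elim_mul_mul {M : Matrix (m ⊕ n) (m ⊕ n) ℂ} (hM : M.PosDef) (L : Matrix m n ℂ) :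
    (elim L * M * (elim L)ᴴ).PosDef := by
  refine hM.mul_mul_conjTranspose_same fun v w hvw => ?_
  have h (u : m → ℂ) (i : m) : (u ᵥ* elim L) (Sum.inl i) = u i := by
    simp [elim]
  funext i
  rw [← h v, ← h w]
  exact congrFun hvw _

theorem posDef_schur {M : Matrix (m ⊕ n) (m ⊕ n) ℂ} (hM : M.PosDef) : (schur M).PosDef := by
  rw [← elim_regr_mul_mul (posDef_toBlocks₂₂ hM)]
  exact posDef_elim_mul_mul hM _

theorem posSemidef_elim_mul_mul_sub_schur {M : Matrix (m ⊕ n) (m ⊕ n) ℂ} (hM : M.PosDef)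
    (L : Matrix m n ℂ) : (elim L * M * (elim L)ᴴ - schur M).PosSemidef := by
  rw [elim_mul_mul hM.isHermitian (posDef_toBlocks₂₂ hM), add_sub_cancel_left]
  exact (posDef_toBlocks₂₂ hM).posSemidef.mul_mul_conjTranspose_same _

theorem det_eq_det_mul_det_schur {M : Matrix (m ⊕ n) (m ⊕ n) ℂ} (h : M.toBlocks₂₂.PosDef) :
    M.det = M.toBlocks₂₂.det * (schur M).det := by
  have := h.isUnit.invertible
  conv_lhs => rw [← fromBlocks_toBlocks M]
  rw [det_fromBlocks₂₂, schur, regr, invOf_eq_nonsing_inv]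

theorem logDet_mul {l : Type*} [Fintype l] [DecidableEq l] {A : Matrix m m ℂ} {B : Matrix n n ℂ}
    {C : Matrix l l ℂ} (hA : A.PosDef) (hB : B.PosDef) (h : C.det = A.det * B.det) :
    logDet C = logDet A + logDet B := by
  rw [logDet, h, det_eq_re hA.posSemidef, Complex.re_ofReal_mul,
    Real.log_mul (re_det_pos hA).ne' (re_det_pos hB).ne']
  rfl

theorem logDet_eq_add_schur {M : Matrix (m ⊕ n) (m ⊕ n) ℂ} (hM : M.PosDef) :
    logDet M = logDet M.toBlocks₂₂ + logDet (schur M) :=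
  logDet_mul (posDef_toBlocks₂₂ hM) (posDef_schur hM)
    (det_eq_det_mul_det_schur (posDef_toBlocks₂₂ hM))

/-- This is the gradient of log|M| = log|S(M)| + log|M₂₂|. The correction lives in the lower right
block only. -/
theorem inv_eq_schurGrad_add {M : Matrix (m ⊕ n) (m ⊕ n) ℂ} (hM : M.PosDef) :
    M⁻¹ = schurGrad M + fromBlocks 0 0 0 M.toBlocks₂₂⁻¹ := by
  have h2 := posDef_toBlocks₂₂ hM
  refine Matrix.inv_eq_left_inv ?_
  have hS : (schur M)⁻¹ * schur M = 1 :=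
    Matrix.nonsing_inv_mul _ ((Matrix.isUnit_iff_isUnit_det _).1 (posDef_schur hM).isUnit)
  have hD : M.toBlocks₂₂⁻¹ * M.toBlocks₂₂ = 1 :=
    Matrix.nonsing_inv_mul _ ((Matrix.isUnit_iff_isUnit_det _).1 h2.isUnit)
  rw [Matrix.add_mul, schurGrad, Matrix.mul_assoc, elim_regr_mul h2, Matrix.mul_assoc,
    mul_fromCols, hS, Matrix.mul_zero]
  conv_lhs => rw [← fromBlocks_toBlocks M]
  rw [fromBlocks_multiply, elim, conjTranspose_fromCols_eq_fromRows_conjTranspose,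
    fromRows_mul_fromCols, fromBlocks_toBlocks]
  simp only [conjTranspose_neg, conjTranspose_regr hM.isHermitian h2, fromBlocks_add, hD]
  simp

/-- With the coefficients frozen at `regr M'` the error covariance is linear in the matrix, hence
monotone; passing to the optimal coefficients for M only lowers it. -/
theorem logDet_schur_mono {M M' : Matrix (m ⊕ n) (m ⊕ n) ℂ} (hM : M.PosDef) (hM' : M'.PosDef)
    (h : (M' - M).PosSemidef) : logDet (schur M) ≤ logDet (schur M') := by
  refine logDet_mono (posDef_schur hM') (posDef_schur hM) ?_
  have h1 : schur M' - schur M = elim (regr M') * (M' - M) * (elim (regr M'))ᴴ +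
      (elim (regr M') * M * (elim (regr M'))ᴴ - schur M) := by
    rw [← elim_regr_mul_mul (posDef_toBlocks₂₂ hM'), Matrix.mul_sub, Matrix.sub_mul]
    abel
  rw [h1]
  exact (h.mul_mul_conjTranspose_same _).add (posSemidef_elim_mul_mul_sub_schur hM _)

theorem logDet_add_le₂₂ {M M' : Matrix (m ⊕ n) (m ⊕ n) ℂ} (hM : M.PosDef) (hM' : M'.PosDef)
    (h : (M' - M).PosSemidef) :
    logDet M + logDet M'.toBlocks₂₂ ≤ logDet M' + logDet M.toBlocks₂₂ := by
  have := logDet_schur_mono hM hM' h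
  rw [logDet_eq_add_schur hM, logDet_eq_add_schur hM']
  linarith

theorem logDet_add_le₁₁ {M M' : Matrix (m ⊕ n) (m ⊕ n) ℂ} (hM : M.PosDef) (hM' : M'.PosDef)
    (h : (M' - M).PosSemidef) :
    logDet M + logDet M'.toBlocks₁₁ ≤ logDet M' + logDet M.toBlocks₁₁ := by
  have h1 := logDet_add_le₂₂ (hM.submatrix (Equiv.sumComm n m).injective)
    (hM'.submatrix (Equiv.sumComm n m).injective) (h.submatrix (Equiv.sumComm n m))
  simp only [logDet, det_submatrix_equiv_self] at h1
  exact h1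

theorem trace_schurGrad_mul (M N : Matrix (m ⊕ n) (m ⊕ n) ℂ) :
    (schurGrad M * N).trace =
      ((schur M)⁻¹ * (elim (regr M) * N * (elim (regr M))ᴴ)).trace := by
  rw [schurGrad, Matrix.mul_assoc, Matrix.mul_assoc, Matrix.trace_mul_comm]
  simp only [Matrix.mul_assoc]

/-- Concavity of `M ↦ log |schur M|`. -/
theorem logDet_schur_le {M M' : Matrix (m ⊕ n) (m ⊕ n) ℂ} (hM : M.PosDef) (hM' : M'.PosDef) :
    logDet (schur M') ≤ logDet (schur M) + (schurGrad M * (M' - M)).trace.re := by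
  -- The coefficients of M are suboptimal for M', and with them the error covariance is linear in
  -- M'.
  have h1 := logDet_mono (posDef_elim_mul_mul hM' (regr M)) (posDef_schur hM')
    (posSemidef_elim_mul_mul_sub_schur hM' _)
  have h2 := logDet_le_add_trace (posDef_elim_mul_mul hM' (regr M)) (posDef_schur hM)
  rw [← trace_schurGrad_mul] at h2
  have h3 : (schurGrad M * M).trace = Fintype.card m := by
    rw [trace_schurGrad_mul, elim_regr_mul_mul (posDef_toBlocks₂₂ hM), Matrix.nonsing_inv_mul _
      ((Matrix.isUnit_iff_isUnit_det _).1 (posDef_schur hM).isUnit), trace_one]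
  rw [Matrix.mul_sub, trace_sub, h3]
  simp only [Complex.sub_re, Complex.natCast_re]
  linarith

end Schur

/-! ### A lower bound on the objective from the stationarity relation. -/

section Certificate

variable {m n p : Type*} [Fintype m] [Fintype n] [Fintype p] [DecidableEq m] [DecidableEq n]
  [DecidableEq p]

/-- The orthogonal projection onto the range of `Nᴴ`. -/
theorem exists_orthogonal_projection (N : Matrix m p ℂ) :
    ∃ (Θ : Matrix p p ℂ) (Z : Matrix m p ℂ), Θᴴ = Θ ∧ Θ * Θ = Θ ∧ N * Θ = N ∧ Θ = Nᴴ * Z := by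
  have hB : (Nᴴ * N).IsHermitian := isHermitian_conjTranspose_mul_self N
  have hspec := hB.spectral_theorem
  rw [Unitary.conjStarAlgAut_apply] at hspec
  have hUU : (hB.eigenvectorUnitary : Matrix p p ℂ)ᴴ * (hB.eigenvectorUnitary : Matrix p p ℂ) = 1 :=
    Unitary.coe_star_mul_self hB.eigenvectorUnitary
  generalize (hB.eigenvectorUnitary : Matrix p p ℂ) = U at hspec hUU
  generalize hB.eigenvalues = l at hspec
  rw [star_eq_conjTranspose] at hspec
  have hconj (D E : p → ℂ) : U * diagonal D * Uᴴ * (U * diagonal E * Uᴴ) =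
      U * diagonal (fun i => D i * E i) * Uᴴ := by
    calc _ = U * diagonal D * (Uᴴ * U) * diagonal E * Uᴴ := by simp only [Matrix.mul_assoc]
      _ = _ := by rw [hUU, Matrix.mul_one, Matrix.mul_assoc U, diagonal_mul_diagonal]
  -- As `0⁻¹ = 0`, the products `l i * (l i)⁻¹` are 1 off the kernel of NᴴN and 0 on it, so this is
  -- a pseudoinverse.
  have hΘ : Nᴴ * N * (U * diagonal (fun i => ((l i)⁻¹ : ℂ)) * Uᴴ) =
      U * diagonal (fun i => (l i * (l i)⁻¹ : ℂ)) * Uᴴ := by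
    rw [hspec, hconj]
    congr 3
    funext i
    simp
  have hself : (U * diagonal (fun i => (l i * (l i)⁻¹ : ℂ)) * Uᴴ)ᴴ =
      U * diagonal (fun i => (l i * (l i)⁻¹ : ℂ)) * Uᴴ := by
    simp only [conjTranspose_mul, conjTranspose_conjTranspose, diagonal_conjTranspose,
      Matrix.mul_assoc]
    congr 3
    funext i
    simp
  have hBΘ : Nᴴ * N * (U * diagonal (fun i => (l i * (l i)⁻¹ : ℂ)) * Uᴴ) = Nᴴ * N := by
    rw [hspec, hconj]
    congr 3
    funext i
    by_cases h : l i = 0 <;> simp [h]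
  refine ⟨U * diagonal (fun i => (l i * (l i)⁻¹ : ℂ)) * Uᴴ,
    N * (U * diagonal (fun i => ((l i)⁻¹ : ℂ)) * Uᴴ), hself, ?_, ?_, ?_⟩
  · rw [hconj]
    congr 3
    funext i
    by_cases h : l i = 0 <;> simp [h]
  · set Θ := U * diagonal (fun i => (l i * (l i)⁻¹ : ℂ)) * Uᴴ
    rw [← sub_eq_zero, ← conjTranspose_mul_self_eq_zero, conjTranspose_sub, conjTranspose_mul,
      hself, Matrix.mul_sub, Matrix.sub_mul, Matrix.sub_mul, ← Matrix.mul_assoc, Matrix.mul_assoc Θ,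
      ← Matrix.mul_assoc Nᴴ, Matrix.mul_assoc Θ, hBΘ]
    simp
  · rw [← Matrix.mul_assoc, hΘ]

theorem posDef_one_add {Q : Matrix m m ℂ} (hQ : Q.PosSemidef) : (1 + Q).PosDef :=
  PosDef.one.add_posSemidef hQ

theorem posSemidef_mul_mul_of_projection {q : Type*} [Fintype q] (F : Matrix q p ℂ)
    {Θ : Matrix p p ℂ} (h1 : Θᴴ = Θ) (h2 : Θ * Θ = Θ) : (F * Θ * Fᴴ).PosSemidef := by
  have : F * Θ * Fᴴ = (F * Θ) * (F * Θ)ᴴ := by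
    rw [conjTranspose_mul, h1, Matrix.mul_assoc F Θ (Θ * Fᴴ), ← Matrix.mul_assoc Θ Θ, h2,
      Matrix.mul_assoc]
  rw [this]
  exact posSemidef_self_mul_conjTranspose _

theorem logDet_one : logDet (1 : Matrix m m ℂ) = 0 := by simp [logDet]

/-- If `Y = schur M + L Kbᴴ` satisfies `Y Kb = L`, where `M = K + F Fᴴ` and `L = regr M`, then
`log |Y|` bounds the objective from below at every noise covariance. -/
theorem logDet_le_of_regr_eq {Kb : Matrix m n ℂ} {F : Matrix (m ⊕ n) p ℂ}
    {M : Matrix (m ⊕ n) (m ⊕ n) ℂ} (hM : M = fromBlocks 1 Kb Kbᴴ 1 + F * Fᴴ)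
    {Y : Matrix m m ℂ} (hY : Y = schur M + regr M * Kbᴴ) (hYK : Y * Kb = regr M)
    {K : Matrix (m ⊕ n) (m ⊕ n) ℂ} (hK : K.PosDef) (hK₁ : K.toBlocks₁₁ = 1)
    (hK₂ : K.toBlocks₂₂ = 1) :
    logDet K + logDet (1 + (F * Fᴴ).toBlocks₂₂) + logDet Y ≤ logDet (K + F * Fᴴ) := by
  have hF : F = fromRows F.toRows₁ F.toRows₂ := (fromRows_toRows F).symm
  have hFF (Θ : Matrix p p ℂ) : F * Θ * Fᴴ =
      fromBlocks (F.toRows₁ * Θ * F.toRows₁ᴴ) (F.toRows₁ * Θ * F.toRows₂ᴴ)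
        (F.toRows₂ * Θ * F.toRows₁ᴴ) (F.toRows₂ * Θ * F.toRows₂ᴴ) := by
    conv_lhs => rw [hF]
    rw [conjTranspose_fromRows_eq_fromCols_conjTranspose, fromRows_mul, fromRows_mul_fromCols]
  have hM₂ : M.toBlocks₂₂.PosDef := by
    have h := hFF 1
    simp only [Matrix.mul_one] at h
    rw [hM, h, fromBlocks_add, toBlocks_fromBlocks₂₂]
    exact posDef_one_add (posSemidef_self_mul_conjTranspose _)
  set L := regr M
  set Fb := F.toRows₁
  set Fe := F.toRows₂
  have hN : elim L * F = Fb - L * Fe := by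
    conv_lhs => rw [hF]
    rw [elim, fromCols_mul_fromRows]
    simp [sub_eq_add_neg]
  -- The regression identity [I, −L] M = [S(M), 0], solved for the signal part [I, −L] F Fᴴ.
  have hNF : fromCols (elim L * F * Fbᴴ) (elim L * F * Feᴴ) = fromCols (Y - 1) ((Y - 1) * Kb) := by
    have h1 : elim L * (fromBlocks 1 Kb Kbᴴ 1 + F * Fᴴ) = fromCols (schur M) 0 := by
      rw [← hM]
      exact elim_regr_mul hM₂
    have h2 : Fᴴ = fromCols Fbᴴ Feᴴ := by
      rw [hF, conjTranspose_fromRows_eq_fromCols_conjTranspose]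
    rw [Matrix.mul_add, ← Matrix.mul_assoc, elim_mul, ← eq_sub_iff_add_eq'] at h1
    rw [← mul_fromCols, ← h2, h1]
    simp only [toBlocks_fromBlocks₁₁, toBlocks_fromBlocks₁₂, toBlocks_fromBlocks₂₁,
      toBlocks_fromBlocks₂₂, Matrix.mul_one, hY, Matrix.sub_mul, Matrix.one_mul]
    rw [← hY, hYK]
    ext i (j | j) <;> simp [hY]
    ring
  obtain ⟨hNb, hNe⟩ := fromCols_inj hNF
  -- Keep only the signal directions visible in the regression error N = Fb − L Fe.
  obtain ⟨Θ, Z, hΘ, hΘ2, hNΘ, hΘZ⟩ := exists_orthogonal_projection (elim L * F)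
  -- On the range of Nᴴ the eavesdropper's channel is Kbᴴ times the legitimate one, i.e. degraded.
  have hdeg : Fe * Θ = Kbᴴ * (Fb * Θ) := by
    rw [← hNb] at hNe
    have := congrArg conjTranspose hNe
    rw [conjTranspose_mul _ Feᴴ, conjTranspose_mul _ Kb, conjTranspose_mul _ Fbᴴ,
      conjTranspose_conjTranspose, conjTranspose_conjTranspose] at this
    rw [hΘZ, ← Matrix.mul_assoc, this]
    simp only [Matrix.mul_assoc]
  set Φ := Fb * Θ * Fbᴴ
  have hΦe : Fe * Θ * Feᴴ = Kbᴴ * Φ * Kb := by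
    have h1 : Θ * Feᴴ = Θ * Fbᴴ * Kb := by
      have := congrArg conjTranspose hdeg
      simpa only [conjTranspose_mul, hΘ, conjTranspose_conjTranspose] using this
    rw [hdeg, ← hΘ2, ← Matrix.mul_assoc Fb, ← Matrix.mul_assoc, Matrix.mul_assoc _ Θ Feᴴ, h1]
    simp only [Φ, Matrix.mul_assoc]
    rw [← Matrix.mul_assoc Θ Θ, hΘ2]
  have hYΦ : Y * (1 + Kb * (Kbᴴ * Φ)) = 1 + Φ := by
    have h1 : Y - 1 = Φ - L * Kbᴴ * Φ := by
      rw [← hNb, ← hNΘ, hN, Matrix.sub_mul, Matrix.mul_assoc L, hdeg]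
      simp only [Φ, Matrix.sub_mul, Matrix.mul_assoc]
    rw [← hYK] at h1
    rw [Matrix.mul_add, Matrix.mul_one, ← sub_eq_zero]
    have h2 : Y = Y - 1 + 1 := by abel
    nth_rewrite 1 [h2]
    rw [h1]
    simp only [Matrix.mul_assoc]
    abel
  have hpΦ : (1 + Φ).PosDef := posDef_one_add (posSemidef_mul_mul_of_projection _ hΘ hΘ2)
  have hpe : (1 + Fe * Θ * Feᴴ).PosDef :=
    posDef_one_add (posSemidef_mul_mul_of_projection _ hΘ hΘ2)
  have hdetY : Y.det * (1 + Fe * Θ * Feᴴ).det = (1 + Φ).det := by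
    rw [← hYΦ, det_mul, hΦe, det_one_add_mul_comm Kb]
  have hlogY : logDet Y + logDet (1 + Fe * Θ * Feᴴ) = logDet (1 + Φ) := by
    rw [det_eq_re hpe.posSemidef] at hdetY
    have h1 := re_det_pos hpΦ
    have h2 := re_det_pos hpe
    have h3 := congrArg Complex.re hdetY
    rw [Complex.re_mul_ofReal] at h3
    have h4 : 0 < Y.det.re := by
      rw [← h3] at h1
      exact pos_of_mul_pos_left h1 h2.le
    rw [logDet, logDet, logDet, ← h3, Real.log_mul h4.ne' h2.ne']
  have hQ' : (F * Θ * Fᴴ).PosSemidef := posSemidef_mul_mul_of_projection _ hΘ hΘ2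
  have hsub : (K + F * Fᴴ - (K + F * Θ * Fᴴ)).PosSemidef := by
    have h1 : K + F * Fᴴ - (K + F * Θ * Fᴴ) = F * (1 - Θ) * Fᴴ := by
      rw [Matrix.mul_sub, Matrix.sub_mul, Matrix.mul_one]
      abel
    rw [h1]
    refine posSemidef_mul_mul_of_projection _ (by simp [hΘ]) ?_
    simp [Matrix.mul_sub, Matrix.sub_mul, hΘ2]
  -- Shrinking the signal to Θ does not raise the conditional rate, and h2 bounds the joint rate
  -- below by the first receiver's. What remains is log|1 + Φ| − log|1 + Fe Θ Feᴴ| = log|Y|.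
  have h1 := logDet_add_le₂₂ (hK.add_posSemidef hQ')
    (hK.add_posSemidef (posSemidef_self_mul_conjTranspose F)) hsub
  have h2 := logDet_add_le₁₁ hK (hK.add_posSemidef hQ') (by rwa [add_sub_cancel_left])
  have hadd₁ (A B : Matrix (m ⊕ n) (m ⊕ n) ℂ) :
      (A + B).toBlocks₁₁ = A.toBlocks₁₁ + B.toBlocks₁₁ := rfl
  have hadd₂ (A B : Matrix (m ⊕ n) (m ⊕ n) ℂ) :
      (A + B).toBlocks₂₂ = A.toBlocks₂₂ + B.toBlocks₂₂ := rfl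
  rw [hadd₂, hadd₂, hK₂, hFF, toBlocks_fromBlocks₂₂, ← hFF] at h1
  rw [hadd₁, hK₁, hFF, toBlocks_fromBlocks₁₁, ← hFF, logDet_one] at h2
  linarith

end Certificate

/-! ### The stationarity relation without inverses, and perturbations of definite matrices. -/

section Multipliers

variable {m n : Type*} [Fintype m] [Fintype n] [DecidableEq m] [DecidableEq n]

theorem toBlocks₁₂_inv {M : Matrix (m ⊕ n) (m ⊕ n) ℂ} (hM : M.PosDef) :
    M⁻¹.toBlocks₁₂ = -((schur M)⁻¹ * regr M) := by
  have h1 : (elim (regr M))ᴴ * (schur M)⁻¹ * elim (regr M) =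
      fromBlocks ((schur M)⁻¹) (-((schur M)⁻¹ * regr M))
        (-((regr M)ᴴ * (schur M)⁻¹)) ((regr M)ᴴ * (schur M)⁻¹ * regr M) := by
    rw [elim, conjTranspose_fromCols_eq_fromRows_conjTranspose, fromRows_mul,
      fromRows_mul_fromCols]
    simp
  rw [inv_eq_schurGrad_add hM, schurGrad, h1, fromBlocks_add, toBlocks_fromBlocks₁₂, add_zero]

theorem regr_of_toBlocks₂₂_eq_one {K : Matrix (m ⊕ n) (m ⊕ n) ℂ} (h₂ : K.toBlocks₂₂ = 1) :
    regr K = K.toBlocks₁₂ := by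
  rw [regr, h₂, inv_one, Matrix.mul_one]

theorem logDet_schur_of_toBlocks₂₂_eq_one {K : Matrix (m ⊕ n) (m ⊕ n) ℂ} (hK : K.PosDef)
    (h₂ : K.toBlocks₂₂ = 1) : logDet (schur K) = logDet K := by
  rw [logDet_eq_add_schur hK, h₂, logDet_one, zero_add]

/-- Equality of the off-diagonal blocks of `M⁻¹` and `K⁻¹`, written without inverses. -/
theorem regr_eq_of_toBlocks₁₂_inv_eq {M K : Matrix (m ⊕ n) (m ⊕ n) ℂ} (hM : M.PosDef)
    (hK : K.PosDef) (h₁ : K.toBlocks₁₁ = 1) (h₂ : K.toBlocks₂₂ = 1)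
    (h : M⁻¹.toBlocks₁₂ = K⁻¹.toBlocks₁₂) :
    (schur M + regr M * K.toBlocks₂₁) * K.toBlocks₁₂ = regr M ∧
      0 < (schur M + regr M * K.toBlocks₂₁).det.re ∧
      logDet (schur M + regr M * K.toBlocks₂₁) = logDet (schur M) - logDet K := by
  have hS := (Matrix.isUnit_iff_isUnit_det _).1 (posDef_schur hM).isUnit
  have hT := (Matrix.isUnit_iff_isUnit_det _).1 (posDef_schur hK).isUnit
  rw [toBlocks₁₂_inv hM, toBlocks₁₂_inv hK, neg_inj, regr_of_toBlocks₂₂_eq_one h₂] at h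
  have hTK : schur K = 1 - K.toBlocks₁₂ * K.toBlocks₂₁ := by
    rw [schur, regr_of_toBlocks₂₂_eq_one h₂, h₁]
  have hYK : schur M * (schur K)⁻¹ * K.toBlocks₁₂ = regr M := by
    rw [Matrix.mul_assoc, ← h, Matrix.mul_nonsing_inv_cancel_left _ _ hS]
  have hYT : schur M * (schur K)⁻¹ * schur K = schur M :=
    Matrix.nonsing_inv_mul_cancel_right _ _ hT
  -- Y is S(M) S(K)⁻¹ in disguise; the left-hand form still makes sense when K is singular.
  have hY : schur M + regr M * K.toBlocks₂₁ = schur M * (schur K)⁻¹ := by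
    rw [hTK, Matrix.mul_sub, Matrix.mul_one, ← Matrix.mul_assoc, ← hTK, hYK, sub_eq_iff_eq_add]
      at hYT
    exact hYT.symm
  rw [hY, ← logDet_schur_of_toBlocks₂₂_eq_one hK h₂]
  have h3 := congrArg Complex.re (congrArg det hYT)
  rw [det_mul, det_eq_re (posDef_schur hK).posSemidef, Complex.re_mul_ofReal] at h3
  have h1 := re_det_pos (posDef_schur hM)
  have h2 := re_det_pos (posDef_schur hK)
  have h4 : 0 < (schur M * (schur K)⁻¹).det.re := by
    rw [← h3] at h1
    exact pos_of_mul_pos_left h1 h2.le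
  refine ⟨hYK, h4, ?_⟩
  rw [eq_sub_iff_add_eq, logDet, logDet, logDet, ← Real.log_mul h4.ne' h2.ne', h3]

/-- Both signs are needed so that a first-order inequality becomes an equality. Relative to A, E has
eigenvalues l i, and s = 1/(1 + ∑ |l i|) keeps every 1 ± s l i positive. -/
theorem exists_pos_posDef_add_smul {p : Type*} [Fintype p] [DecidableEq p] {A E : Matrix p p ℂ}
    (hA : A.PosDef) (hE : E.IsHermitian) :
    ∃ s : ℝ, 0 < s ∧ (A + s • E).PosDef ∧ (A + (-s) • E).PosDef := by
  obtain ⟨G, l, hG, hAG, hEG⟩ := exists_simultaneous_diagonalization hA hE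
  have hpos : 0 < 1 + ∑ i, |l i| := by positivity
  have key (s : ℝ) (hs : |s| * (1 + ∑ i, |l i|) ≤ 1) : (A + s • E).PosDef := by
    have h1 : A + s • E = star G * diagonal (fun i => ((1 + s * l i : ℝ) : ℂ)) * G := by
      have h2 : diagonal (fun i => ((1 + s * l i : ℝ) : ℂ)) =
          1 + s • diagonal (fun i => (l i : ℂ)) := by
        ext i j
        by_cases h : i = j <;> simp [h]
      rw [h2, star_eq_conjTranspose, Matrix.mul_add, Matrix.add_mul, Matrix.mul_one, ← hAG]
      simp [hEG]
    rw [h1, hG.posDef_star_left_conjugate_iff, posDef_diagonal_iff]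
    intro i
    have h3 : |l i| < 1 + ∑ i, |l i| := by
      have := Finset.single_le_sum (f := fun i => |l i|) (fun j _ => abs_nonneg _)
        (Finset.mem_univ i)
      linarith
    have h4 : |s * l i| < 1 := by
      rw [abs_mul]
      rcases (abs_nonneg s).eq_or_lt with h5 | h5
      · simp [← h5]
      · exact (mul_lt_mul_of_pos_left h3 h5).trans_le hs
    have h5 : 0 < 1 + s * l i := by linarith [(abs_lt.1 h4).1]
    exact_mod_cast h5
  refine ⟨(1 + ∑ i, |l i|)⁻¹, inv_pos.2 hpos, key _ ?_, key _ ?_⟩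
  · rw [abs_of_pos (inv_pos.2 hpos), inv_mul_cancel₀ hpos.ne']
  · rw [abs_neg, abs_of_pos (inv_pos.2 hpos), inv_mul_cancel₀ hpos.ne']

/-! ### Continuity of the matrix operations. -/

section Limits

variable {α : Type*} {f : Filter α}

theorem tendsto_matrix_mul {p q r : Type*} [Fintype q] {u : α → Matrix p q ℂ} {v : α → Matrix q r ℂ}
    {A : Matrix p q ℂ} {B : Matrix q r ℂ} (hu : Tendsto u f (𝓝 A)) (hv : Tendsto v f (𝓝 B)) :
    Tendsto (fun a => u a * v a) f (𝓝 (A * B)) := by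
  refine tendsto_pi_nhds.2 fun i => tendsto_pi_nhds.2 fun j => ?_
  exact tendsto_finsetSum _ fun k _ => (tendsto_pi_nhds.1 (tendsto_pi_nhds.1 hu i) k).mul
    (tendsto_pi_nhds.1 (tendsto_pi_nhds.1 hv k) j)

theorem tendsto_re_trace {p : Type*} [Fintype p] {u : α → Matrix p p ℂ} {A : Matrix p p ℂ}
    (hu : Tendsto u f (𝓝 A)) : Tendsto (fun a => (u a).trace.re) f (𝓝 A.trace.re) :=
  ((Complex.continuous_re.comp continuous_id.matrix_trace).tendsto A).comp hu

theorem tendsto_inv {p : Type*} [Fintype p] [DecidableEq p] {u : α → Matrix p p ℂ}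
    {A : Matrix p p ℂ} (hA : A.PosDef) (hu : Tendsto u f (𝓝 A)) :
    Tendsto (fun a => (u a)⁻¹) f (𝓝 A⁻¹) := by
  simp only [Matrix.inv_def, Ring.inverse_eq_inv']
  have h1 : Tendsto (fun a => (u a).det) f (𝓝 A.det) :=
    (continuous_id.matrix_det.tendsto A).comp hu
  have h2 : Tendsto (fun a => (u a).adjugate) f (𝓝 A.adjugate) :=
    (continuous_id.matrix_adjugate.tendsto A).comp hu
  exact (h1.inv₀ hA.det_pos.ne').smul h2

theorem tendsto_logDet {p : Type*} [Fintype p] [DecidableEq p] {u : α → Matrix p p ℂ}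
    {A : Matrix p p ℂ} (hA : A.det.re ≠ 0) (hu : Tendsto u f (𝓝 A)) :
    Tendsto (fun a => logDet (u a)) f (𝓝 (logDet A)) :=
  (((Complex.continuous_re.comp continuous_id.matrix_det).tendsto A).comp hu).log hA

theorem tendsto_submatrix {p q r t : Type*} {u : α → Matrix p q ℂ} {A : Matrix p q ℂ}
    (hu : Tendsto u f (𝓝 A)) (g : r → p) (h : t → q) :
    Tendsto (fun a => (u a).submatrix g h) f (𝓝 (A.submatrix g h)) :=
  ((continuous_id.matrix_submatrix g h).tendsto A).comp hu

variable {u : α → Matrix (m ⊕ n) (m ⊕ n) ℂ} {M : Matrix (m ⊕ n) (m ⊕ n) ℂ}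

/-- Only the lower right block of the limit must be definite. For K + HXHᴴ it is I + H_e X H_eᴴ, so
singular limits of K are allowed. -/
theorem tendsto_regr (hM : M.toBlocks₂₂.PosDef) (hu : Tendsto u f (𝓝 M)) :
    Tendsto (fun a => regr (u a)) f (𝓝 (regr M)) :=
  tendsto_matrix_mul (tendsto_submatrix hu Sum.inl Sum.inr)
    (tendsto_inv hM (tendsto_submatrix hu Sum.inr Sum.inr))

theorem tendsto_schur (hM : M.toBlocks₂₂.PosDef) (hu : Tendsto u f (𝓝 M)) :
    Tendsto (fun a => schur (u a)) f (𝓝 (schur M)) :=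
  (tendsto_submatrix hu Sum.inl Sum.inl).sub
    (tendsto_matrix_mul (tendsto_regr hM hu) (tendsto_submatrix hu Sum.inr Sum.inl))

theorem tendsto_schurGrad (hM : M.PosDef) (hu : Tendsto u f (𝓝 M)) :
    Tendsto (fun a => schurGrad (u a)) f (𝓝 (schurGrad M)) := by
  have h3 : Continuous fun L : Matrix m n ℂ => elim L := by
    refine continuous_matrix fun i j => ?_
    rcases j with j | j
    · exact continuous_const
    · exact (continuous_id.matrix_elem i j).neg
  have h4 : Continuous fun L : Matrix m n ℂ => (elim L)ᴴ := h3.matrix_conjTranspose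
  have h5 := tendsto_regr (posDef_toBlocks₂₂ hM) hu
  exact tendsto_matrix_mul (tendsto_matrix_mul ((h4.tendsto _).comp h5)
    (tendsto_inv (posDef_schur hM) (tendsto_schur (posDef_toBlocks₂₂ hM) hu)))
    ((h3.tendsto _).comp h5)

end Limits

end Multipliers

/-! ### The objective and its first-order conditions. -/

section Model

variable {Nt Nr Ne : ℕ} (Hb : Matrix (Fin Nr) (Fin Nt) ℂ) (He : Matrix (Fin Ne) (Fin Nt) ℂ)

/-- The covariance `H X Hᴴ` of the received signal. -/
def signal (X : Matrix (Fin Nt) (Fin Nt) ℂ) : Matrix (Fin Nr ⊕ Fin Ne) (Fin Nr ⊕ Fin Ne) ℂ :=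
  extChannel Hb He * X * (extChannel Hb He)ᴴ

theorem posSemidef_signal {X : Matrix (Fin Nt) (Fin Nt) ℂ} (hX : X.PosSemidef) :
    (signal Hb He X).PosSemidef :=
  hX.mul_mul_conjTranspose_same _

theorem toBlocks₂₂_signal (X : Matrix (Fin Nt) (Fin Nt) ℂ) :
    (signal Hb He X).toBlocks₂₂ = He * X * Heᴴ := by
  rw [signal, extChannel, conjTranspose_fromRows_eq_fromCols_conjTranspose, fromRows_mul,
    fromRows_mul_fromCols, toBlocks_fromBlocks₂₂]

theorem signal_add_smul (X Y : Matrix (Fin Nt) (Fin Nt) ℂ) (t : ℝ) :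
    signal Hb He (X + t • (Y - X)) =
      signal Hb He X + t • (signal Hb He Y - signal Hb He X) := by
  simp [signal, Matrix.mul_add, Matrix.add_mul, Matrix.mul_sub, Matrix.sub_mul]

theorem posDef_add_signal {K : Matrix (Fin Nr ⊕ Fin Ne) (Fin Nr ⊕ Fin Ne) ℂ} (hK : K.PosDef)
    {X : Matrix (Fin Nt) (Fin Nt) ℂ} (hX : X.PosSemidef) : (K + signal Hb He X).PosDef :=
  hK.add_posSemidef (posSemidef_signal Hb He hX)

theorem posDef_eavesdropper {X : Matrix (Fin Nt) (Fin Nt) ℂ} (hX : X.PosSemidef) :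
    (1 + He * X * Heᴴ).PosDef :=
  posDef_one_add (hX.mul_mul_conjTranspose_same _)

theorem objective_eq {K : Matrix (Fin Nr ⊕ Fin Ne) (Fin Nr ⊕ Fin Ne) ℂ} (hK : K.PosDef)
    {X : Matrix (Fin Nt) (Fin Nt) ℂ} (hX : X.PosSemidef) :
    objective Hb He K X =
      logDet (K + signal Hb He X) - logDet K - logDet (1 + He * X * Heᴴ) := by
  have h1 := re_det_pos hK
  have h2 := re_det_pos (posDef_add_signal Hb He hK hX)
  have h3 : K * (1 + K⁻¹ * signal Hb He X) = K + signal Hb He X := by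
    rw [Matrix.mul_add, Matrix.mul_one, Matrix.mul_nonsing_inv_cancel_left _ _
      ((Matrix.isUnit_iff_isUnit_det _).1 hK.isUnit)]
  have h4 := congrArg Complex.re (congrArg det h3)
  rw [det_mul, det_eq_re hK.posSemidef, Complex.re_ofReal_mul] at h4
  have h5 : 0 < (1 + K⁻¹ * signal Hb He X).det.re := by
    rw [← h4] at h2
    exact pos_of_mul_pos_right h2 h1.le
  have h6 := re_det_pos (posDef_eavesdropper He hX)
  have h7 : logDet (K + signal Hb He X) = logDet K + logDet (1 + K⁻¹ * signal Hb He X) := by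
    rw [logDet, logDet, logDet, ← h4, Real.log_mul h1.ne' h5.ne']
  rw [h7, add_sub_cancel_left, logDet, logDet, ← Real.log_div h5.ne' h6.ne']
  rfl

variable {K : Matrix (Fin Nr ⊕ Fin Ne) (Fin Nr ⊕ Fin Ne) ℂ}

theorem toBlocks₁₁_of_mem (hK : K ∈ noiseSet Nr Ne) : K.toBlocks₁₁ = 1 := by
  obtain ⟨⟨Kb, rfl⟩, -⟩ := hK
  exact toBlocks_fromBlocks₁₁ _ _ _ _

theorem toBlocks₂₂_of_mem (hK : K ∈ noiseSet Nr Ne) : K.toBlocks₂₂ = 1 := by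
  obtain ⟨⟨Kb, rfl⟩, -⟩ := hK
  exact toBlocks_fromBlocks₂₂ _ _ _ _

theorem mem_noiseSet_iff : K ∈ noiseSet Nr Ne ↔
    K.toBlocks₁₁ = 1 ∧ K.toBlocks₂₂ = 1 ∧ K.PosSemidef := by
  refine ⟨fun h => ⟨toBlocks₁₁_of_mem h, toBlocks₂₂_of_mem h, h.2⟩, fun h => ⟨⟨K.toBlocks₁₂, ?_⟩,
    h.2.2⟩⟩
  rw [conjTranspose_toBlocks₁₂ h.2.2.isHermitian]
  nth_rewrite 1 [← fromBlocks_toBlocks K]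
  rw [h.1, h.2.1]

theorem toBlocks₂₂_add_signal (hK : K ∈ noiseSet Nr Ne) (X : Matrix (Fin Nt) (Fin Nt) ℂ) :
    (K + signal Hb He X).toBlocks₂₂ = 1 + He * X * Heᴴ := by
  rw [← toBlocks₂₂_signal Hb He, ← toBlocks₂₂_of_mem hK]
  rfl

/-- The denominator of the objective is the determinant of the lower right block of K + HXHᴴ, so it
is absorbed by the Schur complement. -/
theorem objective_eq_schur (hK : K ∈ noiseSet Nr Ne) (hKp : K.PosDef)
    {X : Matrix (Fin Nt) (Fin Nt) ℂ} (hX : X.PosSemidef) :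
    objective Hb He K X = logDet (schur (K + signal Hb He X)) - logDet K := by
  rw [objective_eq Hb He hKp hX, logDet_eq_add_schur (posDef_add_signal Hb He hKp hX),
    toBlocks₂₂_add_signal Hb He hK]
  ring

theorem objective_nonneg (hK : K ∈ noiseSet Nr Ne) (hKp : K.PosDef)
    {X : Matrix (Fin Nt) (Fin Nt) ℂ} (hX : X.PosSemidef) : 0 ≤ objective Hb He K X := by
  have h := logDet_add_le₂₂ hKp (posDef_add_signal Hb He hKp hX)
    (by simpa using posSemidef_signal Hb He hX)
  rw [toBlocks₂₂_add_signal Hb He hK, toBlocks₂₂_of_mem hK, logDet_one] at h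
  rw [objective_eq Hb He hKp hX]
  linarith

theorem posDef_add_smul_sub {K' : Matrix (Fin Nr ⊕ Fin Ne) (Fin Nr ⊕ Fin Ne) ℂ} (hK : K.PosDef)
    (hK' : K'.PosDef) {t : ℝ} (h0 : 0 < t) (h1 : t ≤ 1) : (K + t • (K' - K)).PosDef := by
  have : K + t • (K' - K) = t • K' + (1 - t) • K := by module
  rw [this]
  exact (hK'.smul h0).add_posSemidef (hK.posSemidef.smul (sub_nonneg.2 h1))

theorem add_smul_sub_mem {K' : Matrix (Fin Nr ⊕ Fin Ne) (Fin Nr ⊕ Fin Ne) ℂ}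
    (hK : K ∈ noiseSet Nr Ne) (hK' : K' ∈ noiseSet Nr Ne) {t : ℝ} (h0 : 0 < t) (h1 : t ≤ 1) :
    K + t • (K' - K) ∈ noiseSet Nr Ne := by
  rw [mem_noiseSet_iff] at *
  refine ⟨?_, ?_, ?_⟩
  · have : (K + t • (K' - K)).toBlocks₁₁ =
      K.toBlocks₁₁ + t • (K'.toBlocks₁₁ - K.toBlocks₁₁) := rfl
    rw [this, hK.1, hK'.1, sub_self, smul_zero, add_zero]
  · have : (K + t • (K' - K)).toBlocks₂₂ =
      K.toBlocks₂₂ + t • (K'.toBlocks₂₂ - K.toBlocks₂₂) := rfl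
    rw [this, hK.2.1, hK'.2.1, sub_self, smul_zero, add_zero]
  · have : K + t • (K' - K) = t • K' + (1 - t) • K := by module
    rw [this]
    exact (hK'.2.2.smul h0.le).add (hK.2.2.smul (sub_nonneg.2 h1))

theorem tendsto_add_smul {p : Type*} (A D : Matrix p p ℂ) :
    Tendsto (fun t : ℝ => A + t • D) (𝓝[>] 0) (𝓝 A) := by
  have h : Continuous fun t : ℝ => A + t • D := by fun_prop
  have h1 := h.tendsto 0
  simp only [zero_smul, add_zero] at h1
  exact h1.mono_left nhdsWithin_le_nhds

theorem re_trace_mul_smul {p : Type*} [Fintype p] (A D : Matrix p p ℂ) (t : ℝ) :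
    (A * (t • D)).trace.re = t * (A * D).trace.re := by
  rw [Matrix.mul_smul, trace_smul, Complex.smul_re, smul_eq_mul]

/-- First order optimality of a maximizer of the objective over a convex set. -/
theorem trace_schurGrad_le_zero {𝒳 : Set (Matrix (Fin Nt) (Fin Nt) ℂ)}
    (h𝒳 : ∀ X ∈ 𝒳, X.PosSemidef) (hconv : Convex ℝ 𝒳) (hK : K ∈ noiseSet Nr Ne) (hKp : K.PosDef)
    {X X' : Matrix (Fin Nt) (Fin Nt) ℂ} (hX : X ∈ 𝒳)
    (hmax : ∀ X' ∈ 𝒳, objective Hb He K X' ≤ objective Hb He K X) (hX' : X' ∈ 𝒳) :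
    (schurGrad (K + signal Hb He X) * (signal Hb He X' - signal Hb He X)).trace.re ≤ 0 := by
  set M := K + signal Hb He X
  set D := signal Hb He X' - signal Hb He X
  have hM : M.PosDef := posDef_add_signal Hb He hKp (h𝒳 X hX)
  have key : ∀ᶠ t : ℝ in 𝓝[>] 0, (schurGrad (M + t • D) * D).trace.re ≤ 0 := by
    filter_upwards [Ioc_mem_nhdsGT (zero_lt_one (α := ℝ))] with t ht
    have hXt : X + t • (X' - X) ∈ 𝒳 := hconv.add_smul_sub_mem hX hX' ⟨ht.1.le, ht.2⟩
    have hMt : K + signal Hb He (X + t • (X' - X)) = M + t • D := by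
      rw [signal_add_smul, ← add_assoc]
    have hMtp : (M + t • D).PosDef := hMt ▸ posDef_add_signal Hb He hKp (h𝒳 _ hXt)
    have h1 := hmax _ hXt
    rw [objective_eq_schur Hb He hK hKp (h𝒳 _ hXt), objective_eq_schur Hb He hK hKp (h𝒳 _ hX),
      hMt] at h1
    -- Concavity is used at the perturbed point, so no derivative is computed; continuity of the
    -- gradient then gives the claim as t ↓ 0.
    have h2 := logDet_schur_le hMtp hM
    have h3 : M - (M + t • D) = (-t) • D := by module
    rw [h3, re_trace_mul_smul] at h2
    have h4 : t * (schurGrad (M + t • D) * D).trace.re ≤ 0 := by linarith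
    exact nonpos_of_mul_nonpos_right h4 ht.1
  exact le_of_tendsto (tendsto_re_trace (tendsto_matrix_mul
    (tendsto_schurGrad hM (tendsto_add_smul M D)) tendsto_const_nhds)) key

theorem trace_eq_add_toBlocks {m n : Type*} [Fintype m] [Fintype n]
    (A : Matrix (m ⊕ n) (m ⊕ n) ℂ) : A.trace = A.toBlocks₁₁.trace + A.toBlocks₂₂.trace := by
  simp [Matrix.trace, toBlocks₁₁, toBlocks₂₂]

theorem trace_fromBlocks_zero_mul_sub {K' : Matrix (Fin Nr ⊕ Fin Ne) (Fin Nr ⊕ Fin Ne) ℂ}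
    (hK : K ∈ noiseSet Nr Ne) (hK' : K' ∈ noiseSet Nr Ne) (A : Matrix (Fin Nr) (Fin Nr) ℂ)
    (B : Matrix (Fin Ne) (Fin Ne) ℂ) : (fromBlocks A 0 0 B * (K' - K)).trace = 0 := by
  have h1 : (K' - K).toBlocks₁₁ = 0 := by
    have : (K' - K).toBlocks₁₁ = K'.toBlocks₁₁ - K.toBlocks₁₁ := rfl
    rw [this, toBlocks₁₁_of_mem hK, toBlocks₁₁_of_mem hK', sub_self]
  have h2 : (K' - K).toBlocks₂₂ = 0 := by
    have : (K' - K).toBlocks₂₂ = K'.toBlocks₂₂ - K.toBlocks₂₂ := rfl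
    rw [this, toBlocks₂₂_of_mem hK, toBlocks₂₂_of_mem hK', sub_self]
  rw [← fromBlocks_toBlocks (K' - K), h1, h2, fromBlocks_multiply, trace_eq_add_toBlocks]
  simp

/-- The objective at any pair is bounded by its value at a best response, up to the change of the
objective of the `K`-update. -/
theorem objective_le_add_updateObjective {𝒳 : Set (Matrix (Fin Nt) (Fin Nt) ℂ)}
    (h𝒳 : ∀ X ∈ 𝒳, X.PosSemidef) (hconv : Convex ℝ 𝒳) (hK : K ∈ noiseSet Nr Ne) (hKp : K.PosDef)
    {X X' : Matrix (Fin Nt) (Fin Nt) ℂ} (hX : X ∈ 𝒳)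
    (hmax : ∀ X' ∈ 𝒳, objective Hb He K X' ≤ objective Hb He K X) (hX' : X' ∈ 𝒳)
    {K' : Matrix (Fin Nr ⊕ Fin Ne) (Fin Nr ⊕ Fin Ne) ℂ} (hK' : K' ∈ noiseSet Nr Ne)
    (hKp' : K'.PosDef) :
    objective Hb He K' X' ≤ objective Hb He K X +
      (updateObjective (K + signal Hb He X)⁻¹ K' - updateObjective (K + signal Hb He X)⁻¹ K) := by
  have hM := posDef_add_signal Hb He hKp (h𝒳 X hX)
  have hM' := posDef_add_signal Hb He hKp' (h𝒳 X' hX')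
  have h1 := logDet_schur_le hM hM'
  have h2 := trace_schurGrad_le_zero Hb He h𝒳 hconv hK hKp hX hmax hX'
  -- The gradient may be replaced by M⁻¹: their difference is block diagonal, while K' − K has zero
  -- diagonal blocks.
  have h3 : ((K + signal Hb He X)⁻¹ * (K' - K)).trace =
      (schurGrad (K + signal Hb He X) * (K' - K)).trace := by
    rw [inv_eq_schurGrad_add hM, Matrix.add_mul, trace_add, trace_fromBlocks_zero_mul_sub hK hK',
      add_zero]
  have h4 : K' + signal Hb He X' - (K + signal Hb He X) =
      (K' - K) + (signal Hb He X' - signal Hb He X) := by abel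
  rw [h4, Matrix.mul_add, trace_add, Complex.add_re, ← h3, Matrix.mul_sub, trace_sub,
    Complex.sub_re] at h1
  rw [objective_eq_schur Hb He hK hKp (h𝒳 _ hX), objective_eq_schur Hb He hK' hKp' (h𝒳 _ hX')]
  simp only [updateObjective]
  simp only [logDet] at *
  linarith

/-! ### Optimality in the K-update. -/

section Update

variable {Ψ K₁ : Matrix (Fin Nr ⊕ Fin Ne) (Fin Nr ⊕ Fin Ne) ℂ}

/-- First order optimality of a minimizer of the objective of the `K`-update. -/
theorem trace_sub_inv_nonneg (hK₁ : K₁ ∈ noiseSet Nr Ne) (hKp₁ : K₁.PosDef)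
    (hmin : ∀ K ∈ noiseSet Nr Ne, K.PosDef → updateObjective Ψ K₁ ≤ updateObjective Ψ K)
    (hK : K ∈ noiseSet Nr Ne) (hKp : K.PosDef) : 0 ≤ ((Ψ - K₁⁻¹) * (K - K₁)).trace.re := by
  set D := K - K₁
  have key : ∀ᶠ t : ℝ in 𝓝[>] 0, 0 ≤ ((Ψ - (K₁ + t • D)⁻¹) * D).trace.re := by
    filter_upwards [Ioc_mem_nhdsGT (zero_lt_one (α := ℝ))] with t ht
    have hp := posDef_add_smul_sub hKp₁ hKp ht.1 ht.2
    have h1 := hmin _ (add_smul_sub_mem hK₁ hK ht.1 ht.2) hp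
    have h2 := logDet_le_add_trace hKp₁ hp
    change updateObjective Ψ K₁ ≤ updateObjective Ψ (K₁ + t • D) at h1
    change logDet K₁ ≤ logDet (K₁ + t • D) + ((K₁ + t • D)⁻¹ * K₁).trace.re - _ at h2
    change (K₁ + t • D).PosDef at hp
    have h3 : ((K₁ + t • D)⁻¹ * K₁).trace.re =
        Fintype.card (Fin Nr ⊕ Fin Ne) - t * ((K₁ + t • D)⁻¹ * D).trace.re := by
      have h4 : (K₁ + t • D)⁻¹ * K₁ = (K₁ + t • D)⁻¹ * (K₁ + t • D) - (K₁ + t • D)⁻¹ * (t • D) := by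
        rw [← Matrix.mul_sub, add_sub_cancel_right]
      rw [h4, trace_sub, Complex.sub_re, re_trace_mul_smul, Matrix.nonsing_inv_mul _
        ((Matrix.isUnit_iff_isUnit_det _).1 hp.isUnit), trace_one, Complex.natCast_re]
    rw [h3] at h2
    rw [updateObjective, updateObjective, Matrix.mul_add, trace_add, Complex.add_re,
      re_trace_mul_smul] at h1
    rw [Matrix.sub_mul, trace_sub, Complex.sub_re]
    simp only [logDet] at h2
    have h5 : 0 ≤ t * ((Ψ * D).trace.re - ((K₁ + t • D)⁻¹ * D).trace.re) := by linarith
    exact nonneg_of_mul_nonneg_right h5 ht.1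
  refine ge_of_tendsto (tendsto_re_trace (tendsto_matrix_mul (Tendsto.sub tendsto_const_nhds
    (tendsto_inv hKp₁ (tendsto_add_smul K₁ D))) tendsto_const_nhds)) key

/-- At a minimizer `K₁` of the objective of the `K`-update, the off-diagonal blocks of `Ψ` and
`K₁⁻¹` agree. -/
theorem toBlocks₁₂_eq_of_isMin (hΨ : Ψ.IsHermitian) (hK₁ : K₁ ∈ noiseSet Nr Ne)
    (hKp₁ : K₁.PosDef)
    (hmin : ∀ K ∈ noiseSet Nr Ne, K.PosDef → updateObjective Ψ K₁ ≤ updateObjective Ψ K) :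
    Ψ.toBlocks₁₂ = K₁⁻¹.toBlocks₁₂ := by
  set C := Ψ - K₁⁻¹
  have hC : C.IsHermitian := hΨ.sub hKp₁.isHermitian.inv
  -- The test direction is the off-diagonal part of C itself. Feasibility of both ±E forces tr(CE) =
  -- 0, which is the sum of the squared norms of the off-diagonal blocks.
  set E : Matrix (Fin Nr ⊕ Fin Ne) (Fin Nr ⊕ Fin Ne) ℂ :=
    fromBlocks 0 C.toBlocks₁₂ C.toBlocks₂₁ 0
  have hE : E.IsHermitian := by
    rw [IsHermitian, fromBlocks_conjTranspose, conjTranspose_toBlocks₁₂ hC,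
      conjTranspose_toBlocks₂₁ hC]
    simp [E]
  obtain ⟨s, hs, h1, h2⟩ := exists_pos_posDef_add_smul hKp₁ hE
  have hmem (r : ℝ) (hr : (K₁ + r • E).PosDef) : K₁ + r • E ∈ noiseSet Nr Ne := by
    rw [mem_noiseSet_iff]
    have e1 : (K₁ + r • E).toBlocks₁₁ = K₁.toBlocks₁₁ + r • E.toBlocks₁₁ := rfl
    have e2 : (K₁ + r • E).toBlocks₂₂ = K₁.toBlocks₂₂ + r • E.toBlocks₂₂ := rfl
    rw [e1, e2, toBlocks₁₁_of_mem hK₁, toBlocks₂₂_of_mem hK₁, toBlocks_fromBlocks₁₁,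
      toBlocks_fromBlocks₂₂]
    exact ⟨by simp, by simp, hr.posSemidef⟩
  have h3 := trace_sub_inv_nonneg hK₁ hKp₁ hmin (hmem _ h1) h1
  have h4 := trace_sub_inv_nonneg hK₁ hKp₁ hmin (hmem _ h2) h2
  rw [add_sub_cancel_left, re_trace_mul_smul] at h3 h4
  have h5 : (C * E).trace.re = 0 := by
    change 0 ≤ s * (C * E).trace.re at h3
    change 0 ≤ -s * (C * E).trace.re at h4
    have := nonneg_of_mul_nonneg_right h3 hs
    nlinarith
  have h6 : (C * E).trace = (C.toBlocks₁₂ * C.toBlocks₁₂ᴴ).trace +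
      (C.toBlocks₂₁ * C.toBlocks₂₁ᴴ).trace := by
    conv_lhs => rw [← fromBlocks_toBlocks C]
    rw [fromBlocks_multiply, trace_eq_add_toBlocks, conjTranspose_toBlocks₁₂ hC,
      conjTranspose_toBlocks₂₁ hC]
    simp
  have h7 := (posSemidef_self_mul_conjTranspose C.toBlocks₁₂).trace_nonneg
  have h8 := (posSemidef_self_mul_conjTranspose C.toBlocks₂₁).trace_nonneg
  have h9 : (C.toBlocks₁₂ * C.toBlocks₁₂ᴴ).trace = 0 := by
    rw [h6, Complex.add_re] at h5
    rw [Complex.nonneg_iff] at h7 h8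
    exact Complex.ext (by simp; linarith) h7.2.symm
  have h10 : C.toBlocks₁₂ = 0 := trace_mul_conjTranspose_self_eq_zero_iff.1 h9
  have h11 : C.toBlocks₁₂ = Ψ.toBlocks₁₂ - K₁⁻¹.toBlocks₁₂ := rfl
  exact sub_eq_zero.1 (h11 ▸ h10)

/-- The suboptimality of `K` in the `K`-update is its log-determinant divergence from the
minimizer. -/
theorem updateObjective_sub_eq (hΨ : Ψ.IsHermitian) (hK₁ : K₁ ∈ noiseSet Nr Ne)
    (hKp₁ : K₁.PosDef)
    (hmin : ∀ K ∈ noiseSet Nr Ne, K.PosDef → updateObjective Ψ K₁ ≤ updateObjective Ψ K)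
    (hK : K ∈ noiseSet Nr Ne) :
    (K₁⁻¹ * K).trace.re - Fintype.card (Fin Nr ⊕ Fin Ne) - (logDet K - logDet K₁) =
      updateObjective Ψ K - updateObjective Ψ K₁ := by
  have h12 := toBlocks₁₂_eq_of_isMin hΨ hK₁ hKp₁ hmin
  have hC : (Ψ - K₁⁻¹).IsHermitian := hΨ.sub hKp₁.isHermitian.inv
  have h12' : (Ψ - K₁⁻¹).toBlocks₁₂ = 0 := by
    have : (Ψ - K₁⁻¹).toBlocks₁₂ = Ψ.toBlocks₁₂ - K₁⁻¹.toBlocks₁₂ := rfl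
    rw [this, h12, sub_self]
  have h21' : (Ψ - K₁⁻¹).toBlocks₂₁ = 0 := by
    rw [← conjTranspose_toBlocks₁₂ hC, h12', conjTranspose_zero]
  -- Thus Ψ can be exchanged for K₁⁻¹ in the linear term, which leaves exactly the divergence.
  have h1 : ((Ψ - K₁⁻¹) * (K - K₁)).trace = 0 := by
    rw [← fromBlocks_toBlocks (Ψ - K₁⁻¹), h12', h21']
    exact trace_fromBlocks_zero_mul_sub hK₁ hK _ _
  have h2 : (K₁⁻¹ * K₁).trace.re = Fintype.card (Fin Nr ⊕ Fin Ne) := by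
    rw [Matrix.nonsing_inv_mul _ ((Matrix.isUnit_iff_isUnit_det _).1 hKp₁.isUnit), trace_one,
      Complex.natCast_re]
  have h3 := congrArg Complex.re h1
  rw [Matrix.sub_mul, Matrix.mul_sub, Matrix.mul_sub, trace_sub, trace_sub, trace_sub,
    Complex.sub_re, Complex.sub_re, Complex.sub_re, h2, Complex.zero_re] at h3
  simp only [updateObjective, logDet]
  linarith

end Update

end Model

/-! ### Monotonicity in the noise, and facts about the semidefinite cone. -/

section Monotonicity

variable {p : Type*} [Fintype p] [DecidableEq p]

/-- `A ↦ log |A + Q| - log |A|` is antitone. -/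
theorem logDet_add_sub_antitone {A A' Q : Matrix p p ℂ} (hA : A.PosDef)
    (hAA' : (A' - A).PosSemidef) (hQ : Q.PosSemidef) :
    logDet (A' + Q) - logDet A' ≤ logDet (A + Q) - logDet A := by
  obtain ⟨R, hR⟩ := exists_eq_conjTranspose_mul_self hQ
  have hA' : A'.PosDef := by
    have := hA.add_posSemidef hAA'
    rwa [add_sub_cancel] at this
  -- This block matrix has determinant |B| and upper left block B + Q, so log|B| − log|B + Q| falls
  -- under `logDet_add_le₁₁`.
  have hdet (B : Matrix p p ℂ) : (fromBlocks (B + Q) Rᴴ R 1).det = B.det := by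
    rw [det_fromBlocks_one₂₂, hR, add_sub_cancel_right]
  have hcorner {B : Matrix p p ℂ} (hB : B.PosSemidef) :
      (fromBlocks B 0 0 (0 : Matrix p p ℂ)).PosSemidef := by
    have : fromBlocks B 0 0 (0 : Matrix p p ℂ) =
        (fromCols (1 : Matrix p p ℂ) (0 : Matrix p p ℂ))ᴴ * B *
          fromCols (1 : Matrix p p ℂ) (0 : Matrix p p ℂ) := by
      rw [conjTranspose_fromCols_eq_fromRows_conjTranspose, fromRows_mul, fromRows_mul_fromCols]
      simp
    rw [this]
    exact hB.conjTranspose_mul_mul_same _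
  have hpd {B : Matrix p p ℂ} (hB : B.PosDef) : (fromBlocks (B + Q) Rᴴ R 1).PosDef := by
    have h1 : fromBlocks (B + Q) Rᴴ R 1 =
        fromBlocks B 0 0 (0 : Matrix p p ℂ) + (fromCols R 1)ᴴ * fromCols R 1 := by
      rw [conjTranspose_fromCols_eq_fromRows_conjTranspose, fromRows_mul_fromCols, fromBlocks_add,
        hR]
      simp
    have h2 : (fromBlocks (B + Q) Rᴴ R 1).PosSemidef := by
      rw [h1]
      exact (hcorner hB.posSemidef).add (posSemidef_conjTranspose_mul_self _)
    rw [h2.posDef_iff_det_ne_zero, hdet]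
    exact hB.det_pos.ne'
  have h := logDet_add_le₁₁ (hpd hA) (hpd hA') (by
    have : fromBlocks (A' + Q) Rᴴ R 1 - fromBlocks (A + Q) Rᴴ R 1 =
        fromBlocks (A' - A) 0 0 (0 : Matrix p p ℂ) := by
      rw [sub_eq_iff_eq_add, fromBlocks_add]
      simp
      abel
    rw [this]
    exact hcorner hAA')
  rw [toBlocks_fromBlocks₁₁, toBlocks_fromBlocks₁₁] at h
  simp only [logDet, hdet] at h ⊢
  linarith

theorem logDet_smul {A : Matrix p p ℂ} (hA : A.PosDef) {a : ℝ} (ha : 0 < a) :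
    logDet (a • A) = Fintype.card p * Real.log a + logDet A := by
  have h : (a • A).det = ((a ^ Fintype.card p : ℝ) : ℂ) * A.det := by
    have : a • A = (a : ℂ) • A := by ext i j; simp
    rw [this, det_smul]
    simp
  rw [logDet, h, Complex.re_ofReal_mul, Real.log_mul (pow_pos ha _).ne' (re_det_pos hA).ne',
    Real.log_pow]
  rfl

theorem isClosed_posSemidef : IsClosed {A : Matrix p p ℂ | A.PosSemidef} := by
  simp only [posSemidef_iff_dotProduct_mulVec, IsHermitian, Set.ofPred_and, Set.ofPred_forall]
  refine (isClosed_eq continuous_id.matrix_conjTranspose continuous_id).inter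
    (isClosed_iInter fun x => ?_)
  have hc : Continuous fun A : Matrix p p ℂ => star x ⬝ᵥ A *ᵥ x :=
    continuous_const.dotProduct (continuous_id.matrix_mulVec continuous_const)
  simp only [Complex.nonneg_iff, Set.ofPred_and]
  exact (isClosed_le continuous_const (Complex.continuous_re.comp hc)).inter
    (isClosed_eq continuous_const (Complex.continuous_im.comp hc))

theorem firstCountableTopology_matrix (p q : Type*) [Finite p] [Finite q] :
    FirstCountableTopology (Matrix p q ℂ) :=
  inferInstanceAs (FirstCountableTopology (p → q → ℂ))

theorem eq_of_posSemidef_sub {A B : Matrix p p ℂ} (h₁ : (A - B).PosSemidef)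
    (h₂ : (B - A).PosSemidef) : A = B := by
  open scoped MatrixOrder in
  exact le_antisymm (Matrix.le_iff.2 h₂) (Matrix.le_iff.2 h₁)

/-- The principal minor on i, j is 1 − |A i j|². -/
theorem norm_apply_le_one {A : Matrix p p ℂ} (hA : A.PosSemidef) (h : ∀ i, A i i = 1) (i j : p) :
    ‖A i j‖ ≤ 1 := by
  have h1 := (hA.submatrix ![i, j]).det_nonneg
  rw [det_fin_two] at h1
  simp only [submatrix_apply, cons_val_zero, cons_val_one, h, mul_one] at h1
  have h2 : A j i = star (A i j) := (hA.isHermitian.apply j i).symm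
  rw [h2, ← starRingEnd_apply, Complex.mul_conj, Complex.nonneg_iff, Complex.sub_re,
    Complex.ofReal_re, Complex.one_re, Complex.normSq_eq_norm_sq] at h1
  nlinarith [h1.1, norm_nonneg (A i j)]

end Monotonicity

/-! ### Compactness and regularization of the noise set. -/

section NoiseSet

variable {Nr Ne : ℕ}

theorem isClosed_noiseSet : IsClosed (noiseSet Nr Ne) := by
  have : noiseSet Nr Ne = {K | K.toBlocks₁₁ = 1} ∩ ({K | K.toBlocks₂₂ = 1} ∩
      {K | K.PosSemidef}) := by
    ext K
    exact mem_noiseSet_iff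
  rw [this]
  exact (isClosed_eq (continuous_id.matrix_submatrix _ _) continuous_const).inter
    ((isClosed_eq (continuous_id.matrix_submatrix _ _) continuous_const).inter isClosed_posSemidef)

theorem isCompact_noiseSet : IsCompact (noiseSet Nr Ne) := by
  have h : IsCompact (Set.univ.pi fun _ : Fin Nr ⊕ Fin Ne =>
      Set.univ.pi fun _ : Fin Nr ⊕ Fin Ne => Metric.closedBall (0 : ℂ) 1) :=
    isCompact_univ_pi fun _ => isCompact_univ_pi fun _ => isCompact_closedBall _ _
  refine h.of_isClosed_subset isClosed_noiseSet fun K hK i _ j _ => ?_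
  rw [mem_closedBall_zero_iff]
  refine norm_apply_le_one hK.2 (fun i => ?_) i j
  rcases i with i | i
  · have := congrFun (congrFun (toBlocks₁₁_of_mem hK) i) i
    rwa [one_apply_eq] at this
  · have := congrFun (congrFun (toBlocks₂₂_of_mem hK) i) i
    rwa [one_apply_eq] at this

/-- K + εI has diagonal blocks (1 + ε)I; rescaling brings it back, so singular elements are
approximated by definite ones within the set. -/
theorem inv_smul_add_smul_one_mem {K : Matrix (Fin Nr ⊕ Fin Ne) (Fin Nr ⊕ Fin Ne) ℂ}
    (hK : K ∈ noiseSet Nr Ne) {ε : ℝ} (hε : 0 < ε) :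
    (1 + ε)⁻¹ • (K + ε • 1) ∈ noiseSet Nr Ne := by
  have h0 : (1 + ε)⁻¹ * (1 + ε) = 1 := inv_mul_cancel₀ (by positivity)
  rw [mem_noiseSet_iff]
  refine ⟨?_, ?_, (hK.2.add (PosSemidef.one.smul hε.le)).smul (by positivity)⟩
  · have h1 : ((1 + ε)⁻¹ • (K + ε • 1)).toBlocks₁₁ = (1 + ε)⁻¹ • (K.toBlocks₁₁ +
      ε • (1 : Matrix (Fin Nr ⊕ Fin Ne) (Fin Nr ⊕ Fin Ne) ℂ).toBlocks₁₁) := rfl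
    rw [h1, toBlocks₁₁_of_mem hK, ← fromBlocks_one, toBlocks_fromBlocks₁₁]
    calc _ = ((1 + ε)⁻¹ * (1 + ε)) • (1 : Matrix (Fin Nr) (Fin Nr) ℂ) := by module
      _ = 1 := by rw [h0, one_smul]
  · have h1 : ((1 + ε)⁻¹ • (K + ε • 1)).toBlocks₂₂ = (1 + ε)⁻¹ • (K.toBlocks₂₂ +
      ε • (1 : Matrix (Fin Nr ⊕ Fin Ne) (Fin Nr ⊕ Fin Ne) ℂ).toBlocks₂₂) := rfl
    rw [h1, toBlocks₂₂_of_mem hK, ← fromBlocks_one, toBlocks_fromBlocks₂₂]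
    calc _ = ((1 + ε)⁻¹ * (1 + ε)) • (1 : Matrix (Fin Ne) (Fin Ne) ℂ) := by module
      _ = 1 := by rw [h0, one_smul]

theorem posDef_add_smul_one {p : Type*} [Fintype p] [DecidableEq p] {K : Matrix p p ℂ}
    (hK : K.PosSemidef) {ε : ℝ} (hε : 0 < ε) : (K + ε • 1).PosDef :=
  PosDef.posSemidef_add hK (PosDef.one.smul hε)

end NoiseSet

/-! ### The objective at singular noise covariances. -/

section Extended

variable {Nt Nr Ne : ℕ} (Hb : Matrix (Fin Nr) (Fin Nt) ℂ) (He : Matrix (Fin Ne) (Fin Nt) ℂ)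
  {K : Matrix (Fin Nr ⊕ Fin Ne) (Fin Nr ⊕ Fin Ne) ℂ} {X : Matrix (Fin Nt) (Fin Nt) ℂ}

theorem tendsto_objective {α : Type*} {f : Filter α}
    {u : α → Matrix (Fin Nr ⊕ Fin Ne) (Fin Nr ⊕ Fin Ne) ℂ} (hu : ∀ a, (u a).PosDef)
    (hK : K.PosDef) (hX : X.PosSemidef) (h : Tendsto u f (𝓝 K)) :
    Tendsto (fun a => objective Hb He (u a) X) f (𝓝 (objective Hb He K X)) := by
  simp only [objective_eq Hb He (hu _) hX]
  rw [objective_eq Hb He hK hX]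
  exact ((tendsto_logDet (re_det_pos (posDef_add_signal Hb He hK hX)).ne'
    (h.add tendsto_const_nhds)).sub (tendsto_logDet (re_det_pos hK).ne' h)).sub tendsto_const_nhds

/-- The extended objective is lower semicontinuous in `K`. -/
theorem extObjective_le_of_tendsto {l : ℝ}
    {u : ℕ → Matrix (Fin Nr ⊕ Fin Ne) (Fin Nr ⊕ Fin Ne) ℂ} {v : ℕ → ℝ} (hu : ∀ j, (u j).PosDef)
    (hK : K.PosSemidef) (hX : X.PosSemidef) (h : Tendsto u atTop (𝓝 K))
    (hv : Tendsto v atTop (𝓝 l)) (hle : ∀ j, objective Hb He (u j) X ≤ v j) :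
    extObjective Hb He K X ≤ l := by
  rw [extObjective]
  split_ifs with hp
  · exact EReal.coe_le_coe_iff.2
      (le_of_tendsto_of_tendsto' (tendsto_objective Hb He hu hp hX h) hv hle)
  · refine iSup_le fun ε => EReal.coe_le_coe_iff.2 ?_
    have hε : 0 < (ε : ℝ) := ε.2
    -- For fixed ε the shifted matrices have a definite limit, and the shift only lowers the
    -- objective.
    have hadd (j : ℕ) : (u j + (ε : ℝ) • 1).PosDef := posDef_add_smul_one (hu j).posSemidef hε
    refine le_of_tendsto_of_tendsto' (tendsto_objective Hb He hadd (posDef_add_smul_one hK hε) hX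
      (h.add tendsto_const_nhds)) hv fun j => le_trans ?_ (hle j)
    have h1 := logDet_add_sub_antitone (A' := u j + (ε : ℝ) • 1) (hu j)
      (by rw [add_sub_cancel_left]; exact PosSemidef.one.smul hε.le) (posSemidef_signal Hb He hX)
    rw [objective_eq Hb He (hadd j) hX, objective_eq Hb He (hu j) hX]
    linarith

/-- A lower bound of the objective at the invertible noise covariances is one of the extended
objective at all noise covariances. -/
theorem le_extObjective_of_forall_posDef {l : ℝ} (hX : X.PosSemidef)
    (h : ∀ K ∈ noiseSet Nr Ne, K.PosDef → l ≤ objective Hb He K X) (hK : K ∈ noiseSet Nr Ne) :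
    (l : EReal) ≤ extObjective Hb He K X := by
  rw [extObjective]
  split_ifs with hp
  · exact EReal.coe_le_coe_iff.2 (h K hK hp)
  -- Writing K + εI = (1 + ε)K' with K' in the noise set costs at most d log(1 + ε), which vanishes
  -- as ε ↓ 0.
  set d : ℝ := (Fintype.card (Fin Nr ⊕ Fin Ne) : ℝ)
  have hlim : Tendsto (fun ε : ℝ => ((l - d * Real.log (1 + ε) : ℝ) : EReal)) (𝓝[>] 0)
      (𝓝 (l : EReal)) := by
    refine (continuous_coe_real_ereal.tendsto l).comp ?_
    have h1 : ContinuousAt (fun ε : ℝ => l - d * Real.log (1 + ε)) 0 := by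
      refine continuousAt_const.sub (continuousAt_const.mul (ContinuousAt.log ?_ (by norm_num)))
      exact continuousAt_const.add continuousAt_id
    have h2 := h1.tendsto
    simp only [add_zero, Real.log_one, mul_zero, sub_zero] at h2
    exact h2.mono_left nhdsWithin_le_nhds
  refine le_of_tendsto hlim ?_
  filter_upwards [self_mem_nhdsWithin] with ε hε
  have hε0 : 0 < ε := hε
  refine le_trans ?_ (le_iSup _ (⟨ε, hε⟩ : {ε : ℝ // 0 < ε}))
  refine EReal.coe_le_coe_iff.2 ?_
  have ha : 0 < 1 + ε := by positivity
  set K' := (1 + ε)⁻¹ • (K + ε • (1 : Matrix (Fin Nr ⊕ Fin Ne) (Fin Nr ⊕ Fin Ne) ℂ))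
  have hKε : (K + ε • (1 : Matrix (Fin Nr ⊕ Fin Ne) (Fin Nr ⊕ Fin Ne) ℂ)).PosDef :=
    posDef_add_smul_one hK.2 hε0
  have hK'p : K'.PosDef := hKε.smul (inv_pos.2 ha)
  have hK' : K + ε • 1 = (1 + ε) • K' := (smul_inv_smul₀ ha.ne' _).symm
  have h1 := h K' (inv_smul_add_smul_one_mem hK hε0) hK'p
  have h2 : logDet (K' + signal Hb He X) ≤ logDet (K + ε • 1 + signal Hb He X) := by
    refine logDet_mono (posDef_add_signal Hb He hKε hX) (posDef_add_signal Hb He hK'p hX) ?_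
    have h3 : K + ε • 1 + signal Hb He X - (K' + signal Hb He X) = ε • K' := by
      rw [hK']
      module
    rw [h3]
    exact hK'p.posSemidef.smul hε0.le
  rw [objective_eq Hb He hK'p hX] at h1
  rw [objective_eq Hb He hKε hX]
  have h4 : logDet (K + ε • 1) = d * Real.log (1 + ε) + logDet K' := by
    rw [hK', logDet_smul hK'p ha]
  linarith

/-- The lower bound of the objective at a fixed point of the iteration. -/
theorem logDet_le_objective_of_regr_eq {Ks : Matrix (Fin Nr ⊕ Fin Ne) (Fin Nr ⊕ Fin Ne) ℂ}
    (hKs : Ks ∈ noiseSet Nr Ne) (hX : X.PosSemidef)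
    (h : (schur (Ks + signal Hb He X) + regr (Ks + signal Hb He X) * Ks.toBlocks₂₁) *
      Ks.toBlocks₁₂ = regr (Ks + signal Hb He X))
    (hK : K ∈ noiseSet Nr Ne) (hKp : K.PosDef) :
    logDet (schur (Ks + signal Hb He X) + regr (Ks + signal Hb He X) * Ks.toBlocks₂₁) ≤
      objective Hb He K X := by
  obtain ⟨R, hR⟩ := exists_eq_conjTranspose_mul_self hX
  have hF : (extChannel Hb He * Rᴴ) * (extChannel Hb He * Rᴴ)ᴴ = signal Hb He X := by
    rw [signal, hR, conjTranspose_mul, conjTranspose_conjTranspose]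
    simp only [Matrix.mul_assoc]
  have hblocks : Ks = fromBlocks 1 Ks.toBlocks₁₂ Ks.toBlocks₁₂ᴴ 1 := by
    rw [conjTranspose_toBlocks₁₂ hKs.2.isHermitian]
    nth_rewrite 1 [← fromBlocks_toBlocks Ks]
    rw [toBlocks₁₁_of_mem hKs, toBlocks₂₂_of_mem hKs]
  -- Definiteness is required of the competitor K only; Ks may be singular.
  have key := logDet_le_of_regr_eq (Kb := Ks.toBlocks₁₂) (F := extChannel Hb He * Rᴴ)
    (M := Ks + signal Hb He X) (by rw [hF, ← hblocks])
    (Y := schur (Ks + signal Hb He X) + regr (Ks + signal Hb He X) * Ks.toBlocks₂₁)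
    (by rw [conjTranspose_toBlocks₁₂ hKs.2.isHermitian]) h hKp (toBlocks₁₁_of_mem hK)
    (toBlocks₂₂_of_mem hK)
  rw [hF, toBlocks₂₂_signal] at key
  rw [objective_eq Hb He hKp hX]
  linarith

end Extended

/-! ### Convergence of the iteration. -/

namespace IsPBRA

variable {Nt Nr Ne : ℕ} {Hb : Matrix (Fin Nr) (Fin Nt) ℂ} {He : Matrix (Fin Ne) (Fin Nt) ℂ}
  {𝒳 : Set (Matrix (Fin Nt) (Fin Nt) ℂ)} {X : ℕ → Matrix (Fin Nt) (Fin Nt) ℂ}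
  {K : ℕ → Matrix (Fin Nr ⊕ Fin Ne) (Fin Nr ⊕ Fin Ne) ℂ}

theorem mem (h : IsPBRA Hb He 𝒳 X K) : ∀ n, K n ∈ noiseSet Nr Ne
  | 0 => h.init_mem
  | n + 1 => h.K_mem n

theorem posDef (h : IsPBRA Hb He 𝒳 X K) : ∀ n, (K n).PosDef
  | 0 => h.init_posDef
  | n + 1 => h.K_posDef n

theorem updateObjective_le (h : IsPBRA Hb He 𝒳 X K) (n : ℕ) :
    ∀ K' ∈ noiseSet Nr Ne, K'.PosDef →
      updateObjective (K n + signal Hb He (X n))⁻¹ (K (n + 1)) ≤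
        updateObjective (K n + signal Hb He (X n))⁻¹ K' :=
  h.K_min n

/-- The objective decreases at least by the decrease of the objective of the `K`-update. -/
theorem updateObjective_sub_le (h : IsPBRA Hb He 𝒳 X K) (h𝒳 : ∀ X ∈ 𝒳, X.PosSemidef)
    (hconv : Convex ℝ 𝒳) (n : ℕ) :
    updateObjective (K n + signal Hb He (X n))⁻¹ (K n) -
        updateObjective (K n + signal Hb He (X n))⁻¹ (K (n + 1)) ≤
      objective Hb He (K n) (X n) - objective Hb He (K (n + 1)) (X (n + 1)) := by
  have := objective_le_add_updateObjective Hb He h𝒳 hconv (h.mem n) (h.posDef n) (h.X_mem n)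
    (h.X_max n) (h.X_mem (n + 1)) (h.mem (n + 1)) (h.posDef (n + 1))
  linarith

theorem objective_succ_le (h : IsPBRA Hb He 𝒳 X K) (h𝒳 : ∀ X ∈ 𝒳, X.PosSemidef)
    (hconv : Convex ℝ 𝒳) (n : ℕ) :
    objective Hb He (K (n + 1)) (X (n + 1)) ≤ objective Hb He (K n) (X n) := by
  have h1 := h.updateObjective_sub_le h𝒳 hconv n
  have h2 := h.updateObjective_le n (K n) (h.mem n) (h.posDef n)
  linarith

theorem nonneg (h : IsPBRA Hb He 𝒳 X K) (h𝒳 : ∀ X ∈ 𝒳, X.PosSemidef) (n : ℕ) :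
    0 ≤ objective Hb He (K n) (X n) :=
  objective_nonneg Hb He (h.mem n) (h.posDef n) (h𝒳 _ (h.X_mem n))

theorem exists_tendsto (h : IsPBRA Hb He 𝒳 X K) (h𝒳 : ∀ X ∈ 𝒳, X.PosSemidef)
    (hconv : Convex ℝ 𝒳) :
    ∃ l : ℝ, Tendsto (fun n => objective Hb He (K n) (X n)) atTop (𝓝 l) :=
  ⟨_, tendsto_atTop_ciInf (antitone_nat_of_succ_le (h.objective_succ_le h𝒳 hconv))
    ⟨0, by rintro _ ⟨n, rfl⟩; exact h.nonneg h𝒳 n⟩⟩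

/-- The square root of the decrease of the objective. -/
def gap (Hb : Matrix (Fin Nr) (Fin Nt) ℂ) (He : Matrix (Fin Ne) (Fin Nt) ℂ)
    (X : ℕ → Matrix (Fin Nt) (Fin Nt) ℂ)
    (K : ℕ → Matrix (Fin Nr ⊕ Fin Ne) (Fin Nr ⊕ Fin Ne) ℂ) (n : ℕ) : ℝ :=
  √(objective Hb He (K n) (X n) - objective Hb He (K (n + 1)) (X (n + 1)))

theorem tendsto_gap (h : IsPBRA Hb He 𝒳 X K) (h𝒳 : ∀ X ∈ 𝒳, X.PosSemidef)
    (hconv : Convex ℝ 𝒳) : Tendsto (gap Hb He X K) atTop (𝓝 0) := by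
  obtain ⟨l, hl⟩ := h.exists_tendsto h𝒳 hconv
  have h1 := (hl.sub (hl.comp (tendsto_add_atTop_nat 1))).sqrt
  rwa [sub_self, Real.sqrt_zero] at h1

theorem posDef_signal (h : IsPBRA Hb He 𝒳 X K) (h𝒳 : ∀ X ∈ 𝒳, X.PosSemidef) (n : ℕ) :
    (K n + signal Hb He (X n)).PosDef :=
  posDef_add_signal Hb He (h.posDef n) (h𝒳 _ (h.X_mem n))

/-- Consecutive noise covariances are close in the Loewner order. -/
theorem close (h : IsPBRA Hb He 𝒳 X K) (h𝒳 : ∀ X ∈ 𝒳, X.PosSemidef) (hconv : Convex ℝ 𝒳) (n : ℕ)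
    (hgap : gap Hb He X K n < 1) :
    (K n - (1 - gap Hb He X K n) ^ 2 • K (n + 1)).PosSemidef ∧
      ((1 + gap Hb He X K n) ^ 2 • K (n + 1) - K n).PosSemidef ∧
      Fintype.card (Fin Nr ⊕ Fin Ne) * Real.log ((1 - gap Hb He X K n) ^ 2) ≤
        logDet (K n) - logDet (K (n + 1)) := by
  refine close_of_divergence_le (h.posDef n) (h.posDef (n + 1)) (Real.sqrt_nonneg _) hgap ?_
  -- The divergence of K n from K (n + 1) is the decrease of the update objective, which is at most
  -- the squared gap.
  rw [updateObjective_sub_eq (h.posDef_signal h𝒳 n).isHermitian.inv (h.mem (n + 1))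
    (h.posDef (n + 1)) (h.updateObjective_le n) (h.mem n), gap,
    Real.sq_sqrt (sub_nonneg.2 (h.objective_succ_le h𝒳 hconv n))]
  exact h.updateObjective_sub_le h𝒳 hconv n

/-- The limits of `K (t j)` and `K (t j + 1)` agree. -/
theorem eq_of_tendsto (h : IsPBRA Hb He 𝒳 X K) (h𝒳 : ∀ X ∈ 𝒳, X.PosSemidef) (hconv : Convex ℝ 𝒳)
    {t : ℕ → ℕ} (ht : Tendsto t atTop atTop)
    {A B : Matrix (Fin Nr ⊕ Fin Ne) (Fin Nr ⊕ Fin Ne) ℂ}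
    (hA : Tendsto (fun j => K (t j)) atTop (𝓝 A))
    (hB : Tendsto (fun j => K (t j + 1)) atTop (𝓝 B)) : A = B := by
  have hg : Tendsto (fun j => gap Hb He X K (t j)) atTop (𝓝 0) :=
    (h.tendsto_gap h𝒳 hconv).comp ht
  have hlt : ∀ᶠ j in atTop, gap Hb He X K (t j) < 1 := hg.eventually_lt_const zero_lt_one
  refine eq_of_posSemidef_sub ?_ ?_
  · have h1 : Tendsto (fun j => K (t j) - (1 - gap Hb He X K (t j)) ^ 2 • K (t j + 1)) atTop
        (𝓝 (A - ((1 - 0) ^ 2 : ℝ) • B)) :=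
      hA.sub (((tendsto_const_nhds.sub hg).pow 2).smul hB)
    rw [sub_zero, one_pow, one_smul] at h1
    exact isClosed_posSemidef.mem_of_tendsto h1 (hlt.mono fun j hj => (h.close h𝒳 hconv _ hj).1)
  · have h1 : Tendsto (fun j => (1 + gap Hb He X K (t j)) ^ 2 • K (t j + 1) - K (t j)) atTop
        (𝓝 (((1 + 0) ^ 2 : ℝ) • B - A)) :=
      (((tendsto_const_nhds.add hg).pow 2).smul hB).sub hA
    rw [add_zero, one_pow, one_smul] at h1
    exact isClosed_posSemidef.mem_of_tendsto h1 (hlt.mono fun j hj => (h.close h𝒳 hconv _ hj).2.1)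

theorem exists_tendsto_subseq (h : IsPBRA Hb He 𝒳 X K) (hcomp : IsCompact 𝒳) :
    ∃ s : ℕ → ℕ, StrictMono s ∧
      ∃ (Xs : Matrix (Fin Nt) (Fin Nt) ℂ) (Ks : Matrix (Fin Nr ⊕ Fin Ne) (Fin Nr ⊕ Fin Ne) ℂ),
        Tendsto (fun j => (X (s j), K (s j))) atTop (𝓝 (Xs, Ks)) := by
  have := firstCountableTopology_matrix (Fin Nt) (Fin Nt)
  have := firstCountableTopology_matrix (Fin Nr ⊕ Fin Ne) (Fin Nr ⊕ Fin Ne)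
  obtain ⟨⟨Xs, Ks⟩, -, s, hs, hlim⟩ := (hcomp.prod isCompact_noiseSet).tendsto_subseq
    (x := fun n => (X n, K n)) fun n => ⟨h.X_mem n, h.mem n⟩
  exact ⟨s, hs, Xs, Ks, hlim⟩

/-- The limit l of the values separates f(Ks, ·) from f(·, Xs): `hupper` and `hlower` combine to
both saddle inequalities. -/
theorem isSaddlePoint_of_tendsto (h : IsPBRA Hb He 𝒳 X K) (h𝒳 : ∀ X ∈ 𝒳, X.PosSemidef)
    (hconv : Convex ℝ 𝒳) (hcomp : IsCompact 𝒳) {Xs : Matrix (Fin Nt) (Fin Nt) ℂ}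
    {Ks : Matrix (Fin Nr ⊕ Fin Ne) (Fin Nr ⊕ Fin Ne) ℂ} {s : ℕ → ℕ} (hs : StrictMono s)
    (hlim : Tendsto (fun j => (X (s j), K (s j))) atTop (𝓝 (Xs, Ks))) :
    IsSaddlePoint Hb He 𝒳 Xs Ks := by
  obtain ⟨l, hl⟩ := h.exists_tendsto h𝒳 hconv
  have hX : Tendsto (fun j => X (s j)) atTop (𝓝 Xs) := hlim.fst_nhds
  have hK : Tendsto (fun j => K (s j)) atTop (𝓝 Ks) := hlim.snd_nhds
  have hXs : Xs ∈ 𝒳 :=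
    hcomp.isClosed.mem_of_tendsto hX (Eventually.of_forall fun j => h.X_mem (s j))
  have hKs : Ks ∈ noiseSet Nr Ne :=
    isClosed_noiseSet.mem_of_tendsto hK (Eventually.of_forall fun j => h.mem (s j))
  have hupper : ∀ X' ∈ 𝒳, extObjective Hb He Ks X' ≤ l := fun X' hX' =>
    extObjective_le_of_tendsto Hb He (fun j => h.posDef (s j)) hKs.2 (h𝒳 X' hX') hK
      (hl.comp hs.tendsto_atTop) fun j => h.X_max (s j) X' hX'
  have := firstCountableTopology_matrix (Fin Nr ⊕ Fin Ne) (Fin Nr ⊕ Fin Ne)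
  -- Stationarity at step n involves K n and K (n + 1), so the successors must converge too; a
  -- further subsequence achieves this, with the same limit.
  obtain ⟨K₁, hK₁, φ, hφ, hlimφ⟩ := isCompact_noiseSet.tendsto_subseq
    (x := fun j => K (s j + 1)) fun j => h.mem (s j + 1)
  set t := s ∘ φ
  have ht : Tendsto t atTop atTop := hs.tendsto_atTop.comp hφ.tendsto_atTop
  have hKt : Tendsto (fun j => K (t j)) atTop (𝓝 Ks) := hK.comp hφ.tendsto_atTop
  have hXt : Tendsto (fun j => X (t j)) atTop (𝓝 Xs) := hX.comp hφ.tendsto_atTop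
  have hKt₁ : Tendsto (fun j => K (t j + 1)) atTop (𝓝 K₁) := hlimφ
  obtain rfl : Ks = K₁ := h.eq_of_tendsto h𝒳 hconv ht hKt hKt₁
  have hM : Tendsto (fun j => K (t j) + signal Hb He (X (t j))) atTop
      (𝓝 (Ks + signal Hb He Xs)) :=
    hKt.add (tendsto_matrix_mul (tendsto_matrix_mul tendsto_const_nhds hXt) tendsto_const_nhds)
  have hM₂ : (Ks + signal Hb He Xs).toBlocks₂₂.PosDef := by
    rw [toBlocks₂₂_add_signal Hb He hKs]
    exact posDef_eavesdropper He (h𝒳 Xs hXs)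
  have hY : Tendsto (fun j => schur (K (t j) + signal Hb He (X (t j))) +
      regr (K (t j) + signal Hb He (X (t j))) * (K (t j + 1)).toBlocks₂₁) atTop
      (𝓝 (schur (Ks + signal Hb He Xs) + regr (Ks + signal Hb He Xs) * Ks.toBlocks₂₁)) :=
    (tendsto_schur hM₂ hM).add
      (tendsto_matrix_mul (tendsto_regr hM₂ hM) (tendsto_submatrix hKt₁ Sum.inr Sum.inl))
  have hstep (n : ℕ) := regr_eq_of_toBlocks₁₂_inv_eq (h.posDef_signal h𝒳 n) (h.posDef (n + 1))
    (toBlocks₁₁_of_mem (h.mem (n + 1))) (toBlocks₂₂_of_mem (h.mem (n + 1)))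
    (toBlocks₁₂_eq_of_isMin (h.posDef_signal h𝒳 n).isHermitian.inv (h.mem (n + 1))
      (h.posDef (n + 1)) (h.updateObjective_le n))
  have hfix := tendsto_nhds_unique
    (tendsto_matrix_mul hY (tendsto_submatrix hKt₁ Sum.inl Sum.inr))
    ((tendsto_regr hM₂ hM).congr fun j => (hstep (t j)).1.symm)
  set Y := schur (Ks + signal Hb He Xs) + regr (Ks + signal Hb He Xs) * Ks.toBlocks₂₁
  have hg : Tendsto (fun j => gap Hb He X K (t j)) atTop (𝓝 0) :=
    (h.tendsto_gap h𝒳 hconv).comp ht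
  -- At step n, log|Y_n| = f(K_n, X_n) + log|K_n| − log|K_{n+1}|, and the last difference is bounded
  -- below by a term tending to 0. Exponentials are compared because |Y| > 0 is not known
  -- beforehand; it follows from this bound.
  have hexp : Real.exp l ≤ Y.det.re := by
    have h1 : Tendsto (fun j => Real.exp (objective Hb He (K (t j)) (X (t j)) +
        Fintype.card (Fin Nr ⊕ Fin Ne) * Real.log ((1 - gap Hb He X K (t j)) ^ 2))) atTop
        (𝓝 (Real.exp (l + Fintype.card (Fin Nr ⊕ Fin Ne) * Real.log ((1 - 0) ^ 2)))) :=
      ((hl.comp ht).add (tendsto_const_nhds.mul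
        (((tendsto_const_nhds.sub hg).pow 2).log (by norm_num)))).rexp
    rw [sub_zero, one_pow, Real.log_one, mul_zero, add_zero] at h1
    refine le_of_tendsto_of_tendsto h1
      (((Complex.continuous_re.comp continuous_id.matrix_det).tendsto Y).comp hY) ?_
    filter_upwards [hg.eventually_lt_const zero_lt_one] with j hj
    obtain ⟨-, h2, h3⟩ := hstep (t j)
    have h4 := (h.close h𝒳 hconv _ hj).2.2
    have h5 := objective_eq_schur Hb He (h.mem (t j)) (h.posDef (t j)) (h𝒳 _ (h.X_mem (t j)))
    refine (Real.le_log_iff_exp_le h2).1 ?_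
    rw [logDet] at h3
    rw [h3]
    linarith
  have hlY : l ≤ logDet Y := (Real.le_log_iff_exp_le ((Real.exp_pos l).trans_le hexp)).2 hexp
  have hlower : ∀ K' ∈ noiseSet Nr Ne, (l : EReal) ≤ extObjective Hb He K' Xs := fun K' hK' =>
    le_extObjective_of_forall_posDef Hb He (h𝒳 Xs hXs) (fun K'' hK'' hp => hlY.trans
      (logDet_le_objective_of_regr_eq Hb He hKs (h𝒳 Xs hXs) hfix hK'' hp)) hK'
  exact ⟨hXs, hKs, fun X' hX' => (hupper X' hX').trans (hlower Ks hKs),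
    fun K' hK' => (hupper Xs hXs).trans (hlower K' hK')⟩

end IsPBRA

end Wiretap

end

theorem lemma4 {Nt Nr Ne : ℕ}
    (Hb : Matrix (Fin Nr) (Fin Nt) ℂ) (He : Matrix (Fin Ne) (Fin Nt) ℂ)
    (𝒳 : Set (Matrix (Fin Nt) (Fin Nt) ℂ))
    (h𝒳_psd : ∀ X ∈ 𝒳, X.PosSemidef) (h𝒳_convex : Convex ℝ 𝒳) (h𝒳_compact : IsCompact 𝒳)
    (X : ℕ → Matrix (Fin Nt) (Fin Nt) ℂ)
    (K : ℕ → Matrix (Fin Nr ⊕ Fin Ne) (Fin Nr ⊕ Fin Ne) ℂ)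
    (hXK : Wiretap.IsPBRA Hb He 𝒳 X K) :
    ((∀ n, 0 ≤ Wiretap.objective Hb He (K n) (X n)) ∧
      (∀ n, Wiretap.objective Hb He (K (n + 1)) (X (n + 1)) ≤
        Wiretap.objective Hb He (K n) (X n)) ∧
      (∃ l : ℝ, Tendsto (fun n => Wiretap.objective Hb He (K n) (X n)) atTop (𝓝 l))) ∧
    (∃ s : ℕ → ℕ, StrictMono s ∧
      ∃ (Xs : Matrix (Fin Nt) (Fin Nt) ℂ) (Ks : Matrix (Fin Nr ⊕ Fin Ne) (Fin Nr ⊕ Fin Ne) ℂ),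
        Tendsto (fun j => (X (s j), K (s j))) atTop (𝓝 (Xs, Ks))) ∧
    (∀ (Xs : Matrix (Fin Nt) (Fin Nt) ℂ) (Ks : Matrix (Fin Nr ⊕ Fin Ne) (Fin Nr ⊕ Fin Ne) ℂ)
      (s : ℕ → ℕ), StrictMono s →
        Tendsto (fun j => (X (s j), K (s j))) atTop (𝓝 (Xs, Ks)) →
        Wiretap.IsSaddlePoint Hb He 𝒳 Xs Ks) :=
  ⟨⟨hXK.nonneg h𝒳_psd, hXK.objective_succ_le h𝒳_psd h𝒳_convex,
      hXK.exists_tendsto h𝒳_psd h𝒳_convex⟩,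
    hXK.exists_tendsto_subseq h𝒳_compact,
    fun _ _ _ hs hlim => hXK.isSaddlePoint_of_tendsto h𝒳_psd h𝒳_convex h𝒳_compact hs hlim⟩
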